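/- **Theorem (Gaussian mixture estimation).** For a probability distribution $G$ on $\mathbb{R}$ let $f_G(y)=\int \varphi(y-\theta)\,G(d\theta)$, where $\varphi(y)=\frac{1}{\sqrt{2\pi}}e^{-y^2/2}$, be the density of the Gaussian mixture with mixing distribution $G$. For a class $\mathcal{G}$ of probability distributions on $\mathbb{R}$, define the minimax squared Hellinger risk $$R_n(\mathcal{G})=\inf_{\hat f}\ \sup_{G\in\mathcal{G}}\ \mathbb{E}_G\big[H^2(f_G,\hat f)\big],\qquad H^2(f,g)=\int_{\mathbb{R}}\big(\sqrt{f(x)}-\sqrt{g(x)}\big)^2\,dx,$$ where the infimum is over all density estimators $\hat f=\hat f(\cdot\,;Y_1,\dots,Y_n)$, that is, probability densities on $\mathbb{R}$ depending (jointly) measurably on the sample, and under $\mathbb{E}_G$ the observations $Y_1,\dots,Y_n$ are i.i.d. with density $f_G$. Let $\mathcal{P}([-h,h])$ be the set of all probability distributions supported on $[-h,h]$, and let $$\mathsf{SubG}(s)=\big\{G:\ G([-t,t]^c)\le 2e^{-t^2/(2s)}\ \text{ for all } t>0\big\}.$$ 1. (Compactly supported case.) For any $h>0$ there exist constants $c_0=c_0(h)>0$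 and $n_0$ such that for all $n\ge n_0$, $$R_n(\mathcal{P}([-h,h]))\ \ge\ \frac{c_0}{n}\,\frac{\log n}{\log\log n}.$$ 2. (Subgaussian case.) For any $s>0$ there exist constants $c_1=c_1(s)>0$ and $n_0$ such that for all $n\ge n_0$, $$R_n(\mathsf{SubG}(s))\ \ge\ \frac{c_1}{n}\,\log n.$$ -/

import Mathlib

open MeasureTheory ProbabilityTheory
open scoped ENNReal

noncomputable section

/-- The density `f_G(y) = ∫ φ(y - θ) G(dθ)` of the Gaussian location mixture with mixing
distribution `G`, where `φ(y - θ)` is the density of `N(θ, 1)` at `y`. -/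
def gaussianMixtureDensity (G : ProbabilityMeasure ℝ) (y : ℝ) : ℝ :=
  ∫ θ, gaussianPDFReal θ 1 y ∂(G : Measure ℝ)

/-- The law `P_G` on `ℝ` with Lebesgue density `f_G`. -/
def gaussianMixtureLaw (G : ProbabilityMeasure ℝ) : Measure ℝ :=
  volume.withDensity fun y => ENNReal.ofReal (gaussianMixtureDensity G y)

/-- The squared Hellinger distance `H²(f, g) = ∫ (√f - √g)² dx` between two densities with respect
to Lebesgue measure on `ℝ`. -/
def hellingerSq (f g : ℝ → ℝ) : ℝ≥0∞ :=
  ∫⁻ x, ENNReal.ofReal ((√(f x) - √(g x)) ^ 2)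

/-- A density estimator based on `n` real observations: it assigns to each sample `y` a probability
density `fhat y` on `ℝ`, jointly measurably in the sample and the evaluation point. -/
structure IsDensityEstimator (n : ℕ) (fhat : (Fin n → ℝ) → ℝ → ℝ) : Prop where
  measurable : Measurable (Function.uncurry fhat)
  nonneg : ∀ y x, 0 ≤ fhat y x
  lintegral_eq_one : ∀ y, ∫⁻ x, ENNReal.ofReal (fhat y x) = 1

/-- The risk `E_G[H²(f_G, fhat(Y₁, …, Y_n))]`, where `Y₁, …, Y_n` are i.i.d. with density `f_G`. -/
def hellingerRisk (n : ℕ) (fhat : (Fin n → ℝ) → ℝ → ℝ) (G : ProbabilityMeasure ℝ) : ℝ≥0∞ :=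
  ∫⁻ y, hellingerSq (gaussianMixtureDensity G) (fhat y)
    ∂(Measure.pi fun _ : Fin n => gaussianMixtureLaw G)

/-- The minimax squared Hellinger risk `R_n(𝒢) = inf_fhat sup_{G ∈ 𝒢} E_G[H²(f_G, fhat)]`. -/
def minimaxHellingerRisk (n : ℕ) (𝒢 : Set (ProbabilityMeasure ℝ)) : ℝ≥0∞ :=
  ⨅ (fhat : (Fin n → ℝ) → ℝ → ℝ) (_ : IsDensityEstimator n fhat),
    ⨆ G ∈ 𝒢, hellingerRisk n fhat G

/-- The set `P([-h, h])` of all probability distributions supported on `[-h, h]`. -/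
def supportedPriors (h : ℝ) : Set (ProbabilityMeasure ℝ) :=
  {G | (G : Measure ℝ) (Set.Icc (-h) h)ᶜ = 0}

/-- The set `SubG(s)` of all `s`-subgaussian probability distributions:
`G([-t, t]ᶜ) ≤ 2 exp(-t² / (2 s))` for all `t > 0`. -/
def subgaussianPriors (s : ℝ) : Set (ProbabilityMeasure ℝ) :=
  {G | ∀ t : ℝ, 0 < t →
    (G : Measure ℝ) (Set.Icc (-t) t)ᶜ ≤ ENNReal.ofReal (2 * Real.exp (-t ^ 2 / (2 * s)))}

end

/-!
Both bounds come from one construction. Put small equal masses `w = exp (-d) / d` on the grid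
`j ρ / √d`, `1 ≤ j ≤ d`, and the remaining mass at `0`; let `f` be the mixture density. Moving mass
`a j` from `0` to the `j`-th grid point changes `f` by `gaussianBump θ a`, and as long as
`|a j| ≤ w / 2` the new density lies between `f / 2` and `3 f / 2`. For such densities the squared
Hellinger distance and the `χ²` divergence are both comparable to the squared distance in
`L²(1 / f)` (`bumpInner_le_hellingerSq`, `exists_likelihoodRatio`). Choosing coordinates in which the
bumps are orthonormal in `L²(1 / f)` (`exists_bumpInner_orthonormal`), a cube of side of order
`1 / √n` in these coordinates satisfies the hypotheses of Assouad's lemma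
(`le_minimaxHellingerRisk_of_cube`), so the risk is at least of order `d / n`.

The cube fits into the class when bumps of norm `√d` move at most a constant times `w √n` of mass to
each point, that is, when the smoothing by the Gaussian kernel does not destroy too much of `a`. This is
quantified by duality (`sq_le_mul_bumpInner`): by the Cauchy–Schwarz inequality, `a j` is
controlled by the norm of the bump times the `L²(f)` norm of a function `g` whose integral against
the bump is `a j`. For `g` one takes a combination of the exponentials `exp (t y - t² / 2)` with
`t = k / √d`. These have `L²(f)` norm `exp (O(d))`, and turn the problem into Lagrange interpolation
at the nodes `exp (i ρ / d)`, whose coefficients have total mass at most `(C / ρ) ^ d`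
(`exists_lagrange_coeff`). Hence `(C / ρ) ^ d ≤ √n` suffices (`le_minimaxHellingerRisk_of_grid`).

In the subgaussian case `ρ` is a constant: the grid extends to `ρ √d`, where masses of order
`exp (-d)` are allowed, and `d` may be of order `log n`. In the compactly supported case
`ρ = h / √d`, the condition reads `(C √d / h) ^ d ≤ √n`, and `d` may be of order
`log n / log log n`.
-/

open MeasureTheory ProbabilityTheory
open scoped ENNReal

/-! ### Lagrange interpolation with controlled coefficients -/

theorem prod_abs_natCast_sub_eq (d j : ℕ) (hj : j ≤ d) :
    ∏ i ∈ (Finset.range (d + 1)).erase j, |(j : ℝ) - i| =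
      (j.factorial : ℝ) * ((d - j).factorial : ℝ) := by
  induction d, hj using Nat.le_induction with
  | base =>
    rw [Finset.range_add_one, Finset.erase_insert Finset.notMem_range_self]
    rw [← Finset.prod_range_reflect, ← Finset.prod_range_add_one_eq_factorial]
    simp only [Nat.sub_self, Nat.factorial_zero, Nat.cast_one, mul_one, Nat.cast_prod]
    refine Finset.prod_congr rfl fun i hi => ?_
    have hi' := Finset.mem_range.1 hi
    rw [show j - 1 - i = j - (i + 1) by omega, Nat.cast_sub (by omega)]
    rw [sub_sub_cancel, Nat.abs_cast]
  | succ d hd ih =>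
    rw [Finset.range_add_one (n := d + 1),
      Finset.erase_insert_of_ne (show d + 1 ≠ j by omega),
      Finset.prod_insert (by simp), ih, show d + 1 - j = (d - j) + 1 by omega,
      Nat.factorial_succ, abs_sub_comm, abs_of_nonneg (by
        rw [sub_nonneg]; exact_mod_cast (by omega : j ≤ d + 1))]
    push_cast [Nat.cast_sub hd]
    ring

/-- Multiplying out `∏ (b i * (x - a i))` gives coefficients of total mass at most
`∏ |b i| * (1 + |a i|)`. -/
theorem exists_coeff_prod_mul_sub (s : Finset ℕ) (a b : ℕ → ℝ) :
    ∃ c : ℕ → ℝ, (∀ x : ℝ, ∑ k ∈ Finset.range (s.card + 1), c k * x ^ k =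
        ∏ i ∈ s, (b i * (x - a i))) ∧
      ∑ k ∈ Finset.range (s.card + 1), |c k| ≤ ∏ i ∈ s, (|b i| * (1 + |a i|)) := by
  induction s using Finset.induction_on with
  | empty => exact ⟨fun _ => 1, by simp, by simp⟩
  | insert i s hi ih =>
    obtain ⟨c, hc, hS⟩ := ih
    -- The shifted sum comes from multiplying by `x`, the unshifted one from multiplying by `a i`.
    have hsplit : ∀ (N : ℕ) (f g : ℕ → ℝ),
        ∑ k ∈ Finset.range (N + 1), ((if k = 0 then 0 else f (k - 1)) +
          (if k = N then 0 else g k)) =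
        ∑ k ∈ Finset.range N, f k + ∑ k ∈ Finset.range N, g k := by
      intro N f g
      rw [Finset.sum_add_distrib]
      congr 1
      · rw [Finset.sum_range_succ']; simp
      · rw [Finset.sum_range_succ]
        simp only [if_true, add_zero]
        exact Finset.sum_congr rfl fun k hk => by
          rw [if_neg (Finset.mem_range.1 hk).ne]
    refine ⟨fun k => (if k = 0 then 0 else b i * c (k - 1)) +
      (if k = s.card + 1 then 0 else -(b i * a i) * c k), fun x => ?_, ?_⟩
    · rw [Finset.card_insert_of_notMem hi, Finset.prod_insert hi, ← hc]
      have := hsplit (s.card + 1) (fun k => b i * c k * x ^ (k + 1))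
        (fun k => -(b i * a i) * c k * x ^ k)
      have h2 : b i * (x - a i) * ∑ k ∈ Finset.range (s.card + 1), c k * x ^ k =
          ∑ k ∈ Finset.range (s.card + 1), b i * c k * x ^ (k + 1) +
          ∑ k ∈ Finset.range (s.card + 1), -(b i * a i) * c k * x ^ k := by
        rw [← Finset.sum_add_distrib, Finset.mul_sum]
        exact Finset.sum_congr rfl fun k _ => by ring
      rw [h2, ← this]
      refine Finset.sum_congr rfl fun k _ => ?_
      rcases Nat.eq_zero_or_pos k with rfl | hk
      · simp
      · simp only [if_neg hk.ne', Nat.sub_add_cancel hk]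
        split_ifs <;> ring
    · rw [Finset.card_insert_of_notMem hi, Finset.prod_insert hi]
      calc _ ≤ ∑ k ∈ Finset.range (s.card + 1 + 1),
            ((if k = 0 then 0 else |b i| * |c (k - 1)|) +
              (if k = s.card + 1 then 0 else |b i| * |a i| * |c k|)) := by
            refine Finset.sum_le_sum fun k _ => (abs_add_le _ _).trans (add_le_add ?_ ?_)
            · split_ifs <;> simp [abs_mul]
            · split_ifs <;> simp [abs_mul]
        _ = |b i| * (1 + |a i|) * ∑ k ∈ Finset.range (s.card + 1), |c k| := by
            rw [hsplit (s.card + 1) (fun k => |b i| * |c k|) (fun k => |b i| * |a i| * |c k|),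
              ← Finset.mul_sum, ← Finset.mul_sum]
            ring
        _ ≤ _ := by gcongr

theorem sub_le_exp_sub_exp {a b : ℝ} (hb : 0 ≤ b) (hab : b ≤ a) :
    a - b ≤ Real.exp a - Real.exp b := by
  have h1 := Real.add_one_le_exp (a - b)
  have h2 : Real.exp a = Real.exp b * Real.exp (a - b) := by rw [← Real.exp_add]; ring_nf
  have h3 := Real.one_le_exp hb
  nlinarith

theorem two_mul_one_add_exp_one_le : 2 * (1 + Real.exp 1) ≤ Real.exp 3 := by
  have h1 : 2 ≤ Real.exp 1 := by have := Real.add_one_le_exp (1:ℝ); linarith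
  have h2 : Real.exp 3 = Real.exp 1 ^ 3 := by rw [← Real.exp_nat_mul]; norm_num
  rw [h2]
  nlinarith [mul_nonneg (sub_nonneg.2 h1) (sub_nonneg.2 h1),
    mul_pos (Real.exp_pos 1) (Real.exp_pos 1)]

/-- The Lagrange basis polynomial at the nodes `exp (i ρ / d)`, `0 ≤ i ≤ d`, has coefficients of
total mass at most `(e⁴ / ρ) ^ d`. The nodes being `ρ / d`-separated, the denominator is at least
`(ρ / d) ^ d * j! * (d - j)!`, and the factorials compensate for `d ^ d`. -/
theorem exists_lagrange_coeff {d : ℕ} (hd : 0 < d) {ρ : ℝ} (hρ : 0 < ρ) (hρ1 : ρ ≤ 1)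
    (j : ℕ) (hj : j ≤ d) :
    ∃ c : ℕ → ℝ, (∀ i ≤ d, ∑ k ∈ Finset.range (d + 1), c k * Real.exp (i * ρ / d) ^ k =
        if i = j then 1 else 0) ∧
      ∑ k ∈ Finset.range (d + 1), |c k| ≤ (Real.exp 4 / ρ) ^ d := by
  have hd' : (0 : ℝ) < d := by exact_mod_cast hd
  set x : ℕ → ℝ := fun i => Real.exp (i * ρ / d) with hx
  have hcard : ((Finset.range (d + 1)).erase j).card = d := by
    rw [Finset.card_erase_of_mem (Finset.mem_range.2 (by omega))]; simp
  have hsep : ∀ i : ℕ, ρ / d * |(j : ℝ) - i| ≤ |x j - x i| := by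
    intro i
    have key : ∀ p q : ℕ, q ≤ p → ρ / d * |(p : ℝ) - q| ≤ |x p - x q| := by
      intro p q hpq
      have hpq' : (q : ℝ) ≤ p := by exact_mod_cast hpq
      have := sub_le_exp_sub_exp (a := p * ρ / d) (b := q * ρ / d) (by positivity) (by gcongr)
      rw [abs_of_nonneg (sub_nonneg.2 hpq')]
      refine le_trans (le_of_eq ?_) (this.trans (le_abs_self _))
      ring
    rcases le_total i j with h | h
    · exact key j i h
    · rw [abs_sub_comm, abs_sub_comm (x j)]; exact key i j h
  have hinj : ∀ i, i ≠ j → x j - x i ≠ 0 := by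
    intro i hij h0
    have := hsep i
    rw [h0, abs_zero] at this
    have h2 : (0 : ℝ) < |(j : ℝ) - i| := abs_pos.2 (sub_ne_zero.2 (by exact_mod_cast hij.symm))
    have : 0 < ρ / d * |(j : ℝ) - i| := by positivity
    linarith
  obtain ⟨c, hc, hS⟩ := exists_coeff_prod_mul_sub ((Finset.range (d + 1)).erase j) x
    (fun i => (x j - x i)⁻¹)
  rw [hcard] at hc hS
  refine ⟨c, fun i hi => ?_, hS.trans ?_⟩
  · rw [hc]
    split_ifs with h
    · subst h
      exact Finset.prod_eq_one fun k hk => inv_mul_cancel₀ (hinj k (Finset.ne_of_mem_erase hk))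
    · exact Finset.prod_eq_zero (Finset.mem_erase.2 ⟨h, Finset.mem_range.2 (by omega)⟩)
        (by simp [hx])
  · have hxle : ∀ i ∈ (Finset.range (d + 1)).erase j, 1 + |x i| ≤ 1 + Real.exp 1 := by
      intro i hi
      have hi' : i ≤ d := by
        have := Finset.mem_range.1 (Finset.mem_of_mem_erase hi); omega
      have hi2 : (i : ℝ) ≤ d := by exact_mod_cast hi'
      rw [abs_of_pos (Real.exp_pos _)]
      gcongr
      rw [div_le_one hd']
      nlinarith
    have hprod : (ρ / d) ^ d * ((j.factorial : ℝ) * ((d - j).factorial : ℝ)) ≤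
        ∏ i ∈ (Finset.range (d + 1)).erase j, |x j - x i| := by
      rw [← prod_abs_natCast_sub_eq d j hj]
      calc _ = ∏ i ∈ (Finset.range (d + 1)).erase j, (ρ / d * |(j : ℝ) - i|) := by
            rw [Finset.prod_mul_distrib, Finset.prod_const, hcard]
        _ ≤ _ := Finset.prod_le_prod (fun i _ => by positivity) fun i _ => hsep i
    -- `(d / e) ^ d ≤ d! ≤ 2 ^ d * j! * (d - j)!`
    have hfact : (d : ℝ) ^ d * Real.exp (-d) ≤
        2 ^ d * ((j.factorial : ℝ) * ((d - j).factorial : ℝ)) := by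
      have h1 := Real.pow_div_factorial_le_exp (x := d) hd'.le d
      rw [div_le_iff₀ (by positivity)] at h1
      have h2 : (d.factorial : ℝ) ≤ 2 ^ d * ((j.factorial : ℝ) * ((d - j).factorial : ℝ)) := by
        have h3 := Nat.choose_mul_factorial_mul_factorial hj
        have h4 : d.choose j ≤ 2 ^ d := Nat.choose_le_two_pow d j
        have h5 : d.factorial ≤ 2 ^ d * (j.factorial * (d - j).factorial) := by
          rw [← h3, mul_assoc]; gcongr
        exact_mod_cast h5
      rw [Real.exp_neg, ← div_eq_mul_inv, div_le_iff₀ (Real.exp_pos _)]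
      nlinarith [Real.exp_pos (d : ℝ)]
    have hlow : (ρ / (2 * Real.exp 1)) ^ d ≤
        ∏ i ∈ (Finset.range (d + 1)).erase j, |x j - x i| := by
      refine le_trans ?_ hprod
      have hexp : Real.exp 1 ^ d = Real.exp d := by rw [← Real.exp_nat_mul]; simp
      have : (ρ / (2 * Real.exp 1)) ^ d = (ρ / d) ^ d * ((d : ℝ) ^ d * Real.exp (-d) / 2 ^ d) := by
        rw [div_pow, div_pow, mul_pow, hexp, Real.exp_neg]
        field_simp
      rw [this]
      gcongr
      rw [div_le_iff₀ (by positivity)]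
      linarith
    have hpos : 0 < (ρ / (2 * Real.exp 1)) ^ d := by positivity
    calc ∏ i ∈ (Finset.range (d + 1)).erase j, (|(x j - x i)⁻¹| * (1 + |x i|))
        = (∏ i ∈ (Finset.range (d + 1)).erase j, |x j - x i|)⁻¹ *
          ∏ i ∈ (Finset.range (d + 1)).erase j, (1 + |x i|) := by
          rw [Finset.prod_mul_distrib, ← Finset.prod_inv_distrib]
          simp [abs_inv]
      _ ≤ ((ρ / (2 * Real.exp 1)) ^ d)⁻¹ * (1 + Real.exp 1) ^ d := by
          gcongr
          refine (Finset.prod_le_prod (fun i _ => by positivity) hxle).trans (le_of_eq ?_)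
          rw [Finset.prod_const, hcard]
      _ = (2 * (1 + Real.exp 1) * Real.exp 1 / ρ) ^ d := by
          rw [← inv_pow, ← mul_pow]
          congr 1
          field_simp
      _ ≤ (Real.exp 4 / ρ) ^ d := by
          have h4 : Real.exp 4 = Real.exp 3 * Real.exp 1 := by rw [← Real.exp_add]; norm_num
          rw [h4]
          gcongr
          exact two_mul_one_add_exp_one_le

/-! ### Testing, selection and Assouad's lemma -/

theorem sq_withDensity_apply_le {α : Type*} [MeasurableSpace α] (μ : Measure α) {L : α → ℝ≥0∞}
    (hL : Measurable L) {S : Set α} (hS : MeasurableSet S) :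
    (μ.withDensity L S) ^ 2 ≤ μ S * ∫⁻ x, L x ^ 2 ∂μ := by
  have h := ENNReal.lintegral_mul_le_Lp_mul_Lq (μ.restrict S) Real.HolderConjugate.two_two
    (aemeasurable_const (b := (1 : ℝ≥0∞))) hL.aemeasurable
  simp only [Pi.mul_apply, one_mul, lintegral_const, Measure.restrict_apply,
    MeasurableSet.univ, Set.univ_inter, ENNReal.rpow_two, one_pow] at h
  rw [withDensity_apply _ hS]
  calc _ ≤ (μ S ^ (1 / 2 : ℝ) * (∫⁻ x in S, L x ^ 2 ∂μ) ^ (1 / 2 : ℝ)) ^ 2 := by gcongr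
    _ = μ S * ∫⁻ x in S, L x ^ 2 ∂μ := by
      rw [mul_pow, ← ENNReal.rpow_two, ← ENNReal.rpow_two, ← ENNReal.rpow_mul, ← ENNReal.rpow_mul]
      norm_num
    _ ≤ _ := by gcongr; exact Measure.restrict_le_self

theorem lintegral_pi_prod_eq_prod {ι α : Type*} [Fintype ι] [MeasurableSpace α] (μ : Measure α)
    [IsProbabilityMeasure μ] {f : ι → α → ℝ≥0∞} (hf : ∀ i, Measurable (f i)) :
    ∫⁻ y, ∏ i, f i (y i) ∂(Measure.pi fun _ : ι => μ) = ∏ i, ∫⁻ x, f i x ∂μ := by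
  rw [lintegral_prod_eq_prod_lintegral_of_indepFun Finset.univ
    (fun i (y : ι → α) => f i (y i)) (iIndepFun_pi fun i => (hf i).aemeasurable)
    fun i => (hf i).comp (measurable_pi_apply i)]
  refine Finset.prod_congr rfl fun i _ => ?_
  exact (measurePreserving_eval (fun _ : ι => μ) i).lintegral_comp (hf i)

theorem pi_withDensity_eq {ι α : Type*} [Fintype ι] [MeasurableSpace α] (μ : Measure α)
    [IsProbabilityMeasure μ] {L : α → ℝ≥0∞} (hL : Measurable L) [SigmaFinite (μ.withDensity L)] :
    (Measure.pi fun _ : ι => μ.withDensity L) =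
      (Measure.pi fun _ : ι => μ).withDensity fun y => ∏ i, L (y i) := by
  refine Measure.pi_eq fun s hs => ?_
  rw [withDensity_apply _ (MeasurableSet.univ_pi hs),
    ← lintegral_indicator (MeasurableSet.univ_pi hs)]
  have : ∀ y : ι → α, (Set.univ.pi s).indicator (fun y => ∏ i, L (y i)) y =
      ∏ i, (s i).indicator L (y i) := by
    intro y
    by_cases h : y ∈ Set.univ.pi s
    · rw [Set.indicator_of_mem h]
      exact Finset.prod_congr rfl fun i _ => (Set.indicator_of_mem (h i trivial) _).symm
    · rw [Set.indicator_of_notMem h]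
      simp only [Set.mem_pi, Set.mem_univ, true_imp_iff, not_forall] at h
      obtain ⟨i, hi⟩ := h
      exact (Finset.prod_eq_zero (Finset.mem_univ i) (Set.indicator_of_notMem hi _)).symm
  simp_rw [this]
  rw [lintegral_pi_prod_eq_prod μ fun i => hL.indicator (hs i)]
  exact Finset.prod_congr rfl fun i _ => by
    rw [withDensity_apply _ (hs i), lintegral_indicator (hs i)]

/-- A bounded second moment of the likelihood ratio makes two laws hard to tell apart:
no test has total error below `1/4`. -/
theorem one_quarter_le_add_of_lintegral_sq_le {α : Type*} [MeasurableSpace α] (μ : Measure α)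
    [IsProbabilityMeasure μ] {L : α → ℝ≥0∞} (hL : Measurable L)
    [IsProbabilityMeasure (μ.withDensity L)] (h3 : ∫⁻ x, L x ^ 2 ∂μ ≤ 3)
    {S : Set α} (hS : MeasurableSet S) :
    ENNReal.ofReal (1 / 4) ≤ μ S + μ.withDensity L Sᶜ := by
  have h := (sq_withDensity_apply_le μ hL hS).trans (mul_le_mul_right h3 (μ S))
  rw [← ofReal_measureReal (μ := μ), ← ofReal_measureReal (μ := μ.withDensity L),
    ← ENNReal.ofReal_add measureReal_nonneg measureReal_nonneg]
  rw [← ofReal_measureReal (μ := μ), ← ofReal_measureReal (μ := μ.withDensity L),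
    ← ENNReal.ofReal_pow measureReal_nonneg, show (3 : ℝ≥0∞) = ENNReal.ofReal 3 by norm_num,
    ← ENNReal.ofReal_mul measureReal_nonneg,
    ENNReal.ofReal_le_ofReal_iff (mul_nonneg measureReal_nonneg (by norm_num))] at h
  refine ENNReal.ofReal_le_ofReal ?_
  rw [probReal_compl_eq_one_sub hS]
  nlinarith [sq_nonneg ((μ.withDensity L).real S - 3 / 2)]

theorem one_add_one_div_pow_le_three (n : ℕ) : (1 + 1 / (n : ℝ)) ^ n ≤ 3 := by
  rcases Nat.eq_zero_or_pos n with rfl | hn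
  · norm_num
  have hn' : (0 : ℝ) < n := by exact_mod_cast hn
  calc (1 + 1 / (n : ℝ)) ^ n ≤ Real.exp (1 / n) ^ n := by
        gcongr
        rw [add_comm]; exact Real.add_one_le_exp _
    _ = Real.exp 1 := by rw [← Real.exp_nat_mul]; congr 1; field_simp
    _ ≤ 3 := Real.exp_one_lt_three.le

theorem one_quarter_le_pi_add_pi {α : Type*} [MeasurableSpace α] (n : ℕ) (μ ν : Measure α)
    [IsProbabilityMeasure μ] [IsProbabilityMeasure ν] {L : α → ℝ≥0∞} (hL : Measurable L)
    (hν : ν = μ.withDensity L) (h : ∫⁻ x, L x ^ 2 ∂μ ≤ ENNReal.ofReal (1 + 1 / n))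
    {S : Set (Fin n → α)} (hS : MeasurableSet S) :
    ENNReal.ofReal (1 / 4) ≤
      (Measure.pi fun _ : Fin n => μ) S + (Measure.pi fun _ : Fin n => ν) Sᶜ := by
  subst hν
  have key := pi_withDensity_eq (ι := Fin n) μ hL
  have : IsProbabilityMeasure
      ((Measure.pi fun _ : Fin n => μ).withDensity fun y => ∏ i, L (y i)) := by
    rw [← key]; infer_instance
  rw [key]
  refine one_quarter_le_add_of_lintegral_sq_le _ ?_ ?_ hS
  · exact Finset.measurable_prod _ fun i _ => hL.comp (measurable_pi_apply i)
  · simp_rw [← Finset.prod_pow]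
    rw [lintegral_pi_prod_eq_prod μ (f := fun _ x => L x ^ 2) fun _ => hL.pow_const 2,
      Finset.prod_const, Finset.card_univ, Fintype.card_fin]
    calc _ ≤ ENNReal.ofReal (1 + 1 / n) ^ n := by gcongr
      _ = ENNReal.ofReal ((1 + 1 / n) ^ n) := by rw [ENNReal.ofReal_pow (by positivity)]
      _ ≤ ENNReal.ofReal 3 := ENNReal.ofReal_le_ofReal (one_add_one_div_pow_le_three n)
      _ = 3 := by norm_num

theorem exists_measurable_argmin {ι α : Type*} [Fintype ι] [Nonempty ι] [MeasurableSpace ι]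
    [MeasurableSingletonClass ι] [MeasurableSpace α] {D : ι → α → ℝ≥0∞}
    (hD : ∀ i, Measurable (D i)) :
    ∃ m : α → ι, Measurable m ∧ ∀ x i, D (m x) x ≤ D i x := by
  classical
  suffices H : ∀ s : Finset ι, s.Nonempty →
      ∃ m : α → ι, Measurable m ∧ ∀ x, ∀ i ∈ s, D (m x) x ≤ D i x by
    obtain ⟨m, hm, h⟩ := H Finset.univ Finset.univ_nonempty
    exact ⟨m, hm, fun x i => h x i (Finset.mem_univ i)⟩
  intro s hs
  induction hs using Finset.Nonempty.cons_induction with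
  | singleton a =>
    refine ⟨fun _ => a, measurable_const, fun x i hi => ?_⟩
    rw [Finset.mem_singleton.1 hi]
  | cons a s ha hs ih =>
    obtain ⟨m, hm, h⟩ := ih
    have hcomp : Measurable fun x => D (m x) x := by
      have : Measurable fun p : ι × α => D p.1 p.2 :=
        measurable_from_prod_countable_right fun i => hD i
      exact this.comp (hm.prodMk measurable_id)
    refine ⟨fun x => if D a x ≤ D (m x) x then a else m x,
      Measurable.ite (measurableSet_le (hD a) hcomp) measurable_const hm, fun x i hi => ?_⟩
    dsimp only
    rcases Finset.mem_cons.1 hi with rfl | hi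
    · split_ifs with hc
      · exact le_rfl
      · exact (not_le.1 hc).le
    · split_ifs with hc
      · exact hc.trans (h x i hi)
      · exact h x i hi

/-- The vertex of the Boolean cube obtained from `u` by flipping the coordinate `i`. -/
def flipBit {d : ℕ} (i : Fin d) (u : Fin d → Bool) : Fin d → Bool := Function.update u i (!u i)

theorem flipBit_involutive {d : ℕ} (i : Fin d) : Function.Involutive (flipBit i) := by
  intro u
  simp [flipBit]

/-- **Assouad's lemma.** If no test separates the laws at two neighbouring vertices of the cube with
total error below `1/4`, every estimator of the vertex errs at some vertex in at least one eighth of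
the coordinates on average. -/
theorem exists_le_lintegral_hammingDist {d : ℕ} {Y : Type*} [MeasurableSpace Y]
    (P : (Fin d → Bool) → Measure Y)
    (hP : ∀ u i, ∀ S : Set Y, MeasurableSet S →
      ENNReal.ofReal (1 / 4) ≤ P u S + P (flipBit i u) Sᶜ)
    {m : Y → Fin d → Bool} (hm : Measurable m) :
    ∃ u, ENNReal.ofReal (d / 8) ≤ ∫⁻ y, (hammingDist u (m y) : ℝ≥0∞) ∂(P u) := by
  have hmeas : ∀ (i : Fin d) (b : Bool), MeasurableSet {y | b ≠ m y i} := fun i b =>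
    ((measurable_pi_apply i).comp hm) (MeasurableSet.of_discrete (s := {c | b ≠ c}))
  have hexp : ∀ u, ∫⁻ y, (hammingDist u (m y) : ℝ≥0∞) ∂(P u) =
      ∑ i, P u {y | u i ≠ m y i} := by
    intro u
    have : ∀ y, (hammingDist u (m y) : ℝ≥0∞) =
        ∑ i, ({y | u i ≠ m y i} : Set Y).indicator 1 y := by
      intro y
      simp only [hammingDist, Set.indicator_apply, Pi.one_apply, Set.mem_ofPred_eq,
        Finset.sum_boole]
    simp_rw [this]
    rw [lintegral_finsetSum _ fun i _ => measurable_one.indicator (hmeas i _)]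
    exact Finset.sum_congr rfl fun i _ => by rw [lintegral_indicator_one (hmeas i _)]
  by_contra! hcon
  have hlt : ∑ u, ∑ i, P u {y | u i ≠ m y i} <
      ∑ _u : Fin d → Bool, ENNReal.ofReal (d / 8) := by
    refine ENNReal.sum_lt_sum_of_nonempty Finset.univ_nonempty fun u _ => ?_
    rw [← hexp]; exact hcon u
  have hge : ∀ i, ∑ _u : Fin d → Bool, ENNReal.ofReal (1 / 8) ≤ ∑ u, P u {y | u i ≠ m y i} := by
    intro i
    -- Pairing every vertex with its neighbour across the coordinate `i` yields the testing error.
    have h2 : ∑ u, P u {y | u i ≠ m y i} =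
        ∑ u, P (flipBit i u) {y | u i ≠ m y i}ᶜ := by
      rw [← Equiv.sum_comp (flipBit_involutive i).toPerm]
      refine Finset.sum_congr rfl fun u _ => ?_
      congr 1
      ext y
      simp [flipBit, Function.Involutive.toPerm]
    have h3 : ∑ _u : Fin d → Bool, ENNReal.ofReal (1 / 4) ≤
        2 * ∑ u, P u {y | u i ≠ m y i} := by
      rw [two_mul]
      nth_rewrite 2 [h2]
      rw [← Finset.sum_add_distrib]
      exact Finset.sum_le_sum fun u _ => hP u i _ (hmeas i _)
    have h4 : ENNReal.ofReal (1 / 4) = 2 * ENNReal.ofReal (1 / 8) := by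
      rw [show (2 : ℝ≥0∞) = ENNReal.ofReal 2 by norm_num, ← ENNReal.ofReal_mul (by norm_num)]
      norm_num
    rw [h4, ← Finset.mul_sum] at h3
    exact (ENNReal.mul_le_mul_iff_right (by norm_num) (by norm_num)).1 h3
  refine absurd hlt (not_lt.2 ?_)
  rw [Finset.sum_comm]
  refine le_trans (le_of_eq ?_) (Finset.sum_le_sum fun i _ => hge i)
  rw [Finset.sum_comm]
  refine Finset.sum_congr rfl fun u _ => ?_
  rw [Finset.sum_const, Finset.card_univ, Fintype.card_fin, nsmul_eq_mul,
    ← ENNReal.ofReal_natCast, ← ENNReal.ofReal_mul (by positivity)]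
  congr 1; ring

theorem hellingerSq_comm (f g : ℝ → ℝ) : hellingerSq f g = hellingerSq g f := by
  unfold hellingerSq
  congr 1; ext x
  congr 1; ring

theorem hellingerSq_le_two_mul_add {f g k : ℝ → ℝ} (hf : Measurable f) (hg : Measurable g) :
    hellingerSq f k ≤ 2 * (hellingerSq f g + hellingerSq g k) := by
  unfold hellingerSq
  rw [← lintegral_add_left (by fun_prop), ← lintegral_const_mul' _ _ (by norm_num)]
  refine lintegral_mono fun x => ?_
  rw [← ENNReal.ofReal_add (by positivity) (by positivity),
    show (2 : ℝ≥0∞) = ENNReal.ofReal 2 by norm_num, ← ENNReal.ofReal_mul (by norm_num)]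
  refine ENNReal.ofReal_le_ofReal ?_
  nlinarith [sq_nonneg (√(f x) - √(g x) - (√(g x) - √(k x)))]

/-- Assouad's lemma for the minimax Hellinger risk. The estimated vertex is the one whose density is
nearest to the density estimate. -/
theorem le_minimaxHellingerRisk_of_cube {n d : ℕ} {𝒢 : Set (ProbabilityMeasure ℝ)}
    (G : (Fin d → Bool) → ProbabilityMeasure ℝ) (hG : ∀ u, G u ∈ 𝒢)
    (hmeas : ∀ u, Measurable (gaussianMixtureDensity (G u)))
    (hprob : ∀ u, IsProbabilityMeasure (gaussianMixtureLaw (G u)))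
    {κ : ℝ} (hκ : 0 ≤ κ)
    (hsep : ∀ u v, ENNReal.ofReal κ * hammingDist u v ≤
      hellingerSq (gaussianMixtureDensity (G u)) (gaussianMixtureDensity (G v)))
    (hclose : ∀ u i, ∃ L : ℝ → ℝ≥0∞, Measurable L ∧
      gaussianMixtureLaw (G (flipBit i u)) = (gaussianMixtureLaw (G u)).withDensity L ∧
      ∫⁻ x, L x ^ 2 ∂(gaussianMixtureLaw (G u)) ≤ ENNReal.ofReal (1 + 1 / n)) :
    ENNReal.ofReal (κ * d / 32) ≤ minimaxHellingerRisk n 𝒢 := by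
  refine le_iInf₂ fun fhat hfhat => ?_
  set D : (Fin d → Bool) → (Fin n → ℝ) → ℝ≥0∞ := fun u y =>
    hellingerSq (gaussianMixtureDensity (G u)) (fhat y) with hD
  have hDm : ∀ u, Measurable (D u) := by
    intro u
    have h1 : Measurable fun p : (Fin n → ℝ) × ℝ =>
        ENNReal.ofReal ((√(gaussianMixtureDensity (G u) p.2) - √(fhat p.1 p.2)) ^ 2) := by
      have := hfhat.measurable
      have h2 : Measurable fun p : (Fin n → ℝ) × ℝ => fhat p.1 p.2 := this
      have h3 := hmeas u
      fun_prop
    exact h1.lintegral_prod_right'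
  -- `m y` is within `2 D u y + 2 D (m y) y ≤ 4 D u y` of the true vertex `u`.
  obtain ⟨m, hm, hmin⟩ := exists_measurable_argmin hDm
  obtain ⟨u, hu⟩ := exists_le_lintegral_hammingDist
    (fun u => Measure.pi fun _ : Fin n => gaussianMixtureLaw (G u)) (fun u i S hS => by
      obtain ⟨L, hL, h1, h2⟩ := hclose u i
      have := hprob u
      have := hprob (flipBit i u)
      exact one_quarter_le_pi_add_pi n _ _ hL h1 h2 hS) hm
  refine le_trans ?_ (le_iSup₂_of_le (G u) (hG u) le_rfl)
  have hpt : ∀ y, ENNReal.ofReal (κ / 4) * hammingDist u (m y) ≤ D u y := by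
    intro y
    have h1 := (hsep u (m y)).trans (hellingerSq_le_two_mul_add (hmeas u)
      (hfhat.measurable.of_uncurry_left (x := y)))
    rw [hellingerSq_comm (fhat y)] at h1
    have h2 : ENNReal.ofReal κ * hammingDist u (m y) ≤ 4 * D u y := by
      refine h1.trans ?_
      calc 2 * (D u y + D (m y) y) ≤ 2 * (D u y + D u y) := by gcongr; exact hmin y u
        _ = 4 * D u y := by ring
    have h4 : ENNReal.ofReal κ = 4 * ENNReal.ofReal (κ / 4) := by
      rw [show (4 : ℝ≥0∞) = ENNReal.ofReal 4 by norm_num, ← ENNReal.ofReal_mul (by norm_num)]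
      congr 1; ring
    rw [h4, mul_assoc] at h2
    exact (ENNReal.mul_le_mul_iff_right (by norm_num) (by norm_num)).1 h2
  calc ENNReal.ofReal (κ * d / 32) = ENNReal.ofReal (κ / 4) * ENNReal.ofReal (d / 8) := by
        rw [← ENNReal.ofReal_mul (by positivity)]; congr 1; ring
    _ ≤ ENNReal.ofReal (κ / 4) * ∫⁻ y, (hammingDist u (m y) : ℝ≥0∞)
          ∂(Measure.pi fun _ : Fin n => gaussianMixtureLaw (G u)) := by gcongr
    _ = ∫⁻ y, ENNReal.ofReal (κ / 4) * (hammingDist u (m y) : ℝ≥0∞)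
          ∂(Measure.pi fun _ : Fin n => gaussianMixtureLaw (G u)) :=
        (lintegral_const_mul' _ _ ENNReal.ofReal_ne_top).symm
    _ ≤ hellingerRisk n fhat (G u) := lintegral_mono hpt

/-! ### Finite Gaussian mixtures -/

/-- The combination `∑ a j * (φ(y - θ j) - φ(y))` of Gaussian densities, by which the density of a
mixture over the points `0` and `θ j` changes when mass `a j` moves from `0` to `θ j`. -/
noncomputable def gaussianBump {d : ℕ} (θ a : Fin d → ℝ) (y : ℝ) : ℝ :=
  ∑ j, a j * (gaussianPDFReal (θ j) 1 y - gaussianPDFReal 0 1 y)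

/-- The Gaussian mixture density with mass `p j` at `θ j` and the remaining mass at `0`. -/
noncomputable def finiteMixture {d : ℕ} (θ p : Fin d → ℝ) (y : ℝ) : ℝ :=
  gaussianPDFReal 0 1 y + gaussianBump θ p y

section

variable {d : ℕ} (θ : Fin d → ℝ)

theorem measurable_gaussianBump (a : Fin d → ℝ) : Measurable (gaussianBump θ a) := by
  unfold gaussianBump
  refine Finset.measurable_sum _ fun j _ => ?_
  have h1 := measurable_gaussianPDFReal (θ j) 1
  have h2 := measurable_gaussianPDFReal 0 1
  fun_prop

theorem measurable_finiteMixture (p : Fin d → ℝ) : Measurable (finiteMixture θ p) :=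
  (measurable_gaussianPDFReal 0 1).add (measurable_gaussianBump θ p)

theorem integrable_gaussianBump (a : Fin d → ℝ) : Integrable (gaussianBump θ a) := by
  unfold gaussianBump
  exact integrable_finsetSum _ fun j _ =>
    ((integrable_gaussianPDFReal _ _).sub (integrable_gaussianPDFReal _ _)).const_mul _

theorem integrable_finiteMixture (p : Fin d → ℝ) : Integrable (finiteMixture θ p) :=
  (integrable_gaussianPDFReal 0 1).add (integrable_gaussianBump θ p)

theorem integral_finiteMixture (p : Fin d → ℝ) : ∫ y, finiteMixture θ p y = 1 := by
  unfold finiteMixture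
  rw [integral_add (integrable_gaussianPDFReal 0 1) (integrable_gaussianBump θ p)]
  have : ∫ y, gaussianBump θ p y = 0 := by
    unfold gaussianBump
    rw [integral_finsetSum]
    swap
    · exact fun j _ =>
        ((integrable_gaussianPDFReal _ _).sub (integrable_gaussianPDFReal _ _)).const_mul _
    refine Finset.sum_eq_zero fun j _ => ?_
    rw [integral_const_mul, integral_sub (integrable_gaussianPDFReal _ _)
      (integrable_gaussianPDFReal _ _), integral_gaussianPDFReal_eq_one _ one_ne_zero,
      integral_gaussianPDFReal_eq_one _ one_ne_zero, sub_self, mul_zero]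
  rw [this, integral_gaussianPDFReal_eq_one _ one_ne_zero, add_zero]

theorem gaussianBump_smul (c : ℝ) (a : Fin d → ℝ) (y : ℝ) :
    gaussianBump θ (c • a) y = c * gaussianBump θ a y := by
  simp only [gaussianBump, Pi.smul_apply, smul_eq_mul, Finset.mul_sum, mul_assoc]

theorem finiteMixture_eq (p : Fin d → ℝ) (y : ℝ) :
    finiteMixture θ p y =
      (1 - ∑ j, p j) * gaussianPDFReal 0 1 y + ∑ j, p j * gaussianPDFReal (θ j) 1 y := by
  simp only [finiteMixture, gaussianBump, mul_sub, Finset.sum_sub_distrib, Finset.sum_mul, sub_mul]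
  ring

theorem finiteMixture_const_pos {w : ℝ} (hw : 0 < w) (hdw : d * w ≤ 1 / 2) (y : ℝ) :
    0 < finiteMixture θ (fun _ => w) y := by
  rw [finiteMixture_eq]
  have h0 := gaussianPDFReal_pos 0 1 y one_ne_zero
  have h1 : 0 ≤ ∑ j, w * gaussianPDFReal (θ j) 1 y :=
    Finset.sum_nonneg fun j _ => mul_nonneg hw.le (gaussianPDFReal_nonneg _ _ _)
  have h2 : (0 : ℝ) < 1 - ∑ _j : Fin d, w := by
    rw [Finset.sum_const, Finset.card_univ, Fintype.card_fin, nsmul_eq_mul]; linarith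
  positivity

theorem abs_gaussianBump_le {w : ℝ} (hdw : d * w ≤ 1 / 2)
    {a : Fin d → ℝ} {t : ℝ} (ht : 0 ≤ t) (ha : ∀ j, |a j| ≤ t * w) (y : ℝ) :
    |gaussianBump θ a y| ≤ t * finiteMixture θ (fun _ => w) y := by
  have h0 := gaussianPDFReal_nonneg 0 1 y
  calc |gaussianBump θ a y|
      ≤ ∑ j, |a j| * (gaussianPDFReal (θ j) 1 y + gaussianPDFReal 0 1 y) := by
        refine (Finset.abs_sum_le_sum_abs _ _).trans (Finset.sum_le_sum fun j _ => ?_)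
        rw [abs_mul]
        gcongr
        refine (abs_sub _ _).trans (le_of_eq ?_)
        rw [abs_of_nonneg (gaussianPDFReal_nonneg _ _ _), abs_of_nonneg h0]
    _ ≤ ∑ j : Fin d, t * w * (gaussianPDFReal (θ j) 1 y + gaussianPDFReal 0 1 y) := by
        gcongr with j
        · exact add_nonneg (gaussianPDFReal_nonneg _ _ _) h0
        · exact ha j
    _ = t * (d * w * gaussianPDFReal 0 1 y + ∑ j, w * gaussianPDFReal (θ j) 1 y) := by
        simp only [mul_add, Finset.sum_add_distrib, Finset.mul_sum, Finset.sum_const,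
          Finset.card_univ, Fintype.card_fin, nsmul_eq_mul, mul_assoc]
        ring
    _ ≤ t * finiteMixture θ (fun _ => w) y := by
        rw [finiteMixture_eq, Finset.sum_const, Finset.card_univ, Fintype.card_fin, nsmul_eq_mul]
        gcongr
        linarith

/-- The inner product of two bumps in `L²(1 / f)`, where `f` is the density of the mixture with
mass `w` at each `θ j`. -/
noncomputable def bumpInner (w : ℝ) (a b : Fin d → ℝ) : ℝ :=
  ∫ y, gaussianBump θ a y * gaussianBump θ b y / finiteMixture θ (fun _ => w) y

theorem integrable_bumpInner {w : ℝ} (hw : 0 < w) (hdw : d * w ≤ 1 / 2) (a b : Fin d → ℝ) :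
    Integrable fun y =>
      gaussianBump θ a y * gaussianBump θ b y / finiteMixture θ (fun _ => w) y := by
  set t : ℝ := (∑ j, |a j|) / w with ht
  have ht0 : 0 ≤ t := div_nonneg (Finset.sum_nonneg fun j _ => abs_nonneg _) hw.le
  have ha : ∀ j, |a j| ≤ t * w := by
    intro j
    rw [ht, div_mul_cancel₀ _ hw.ne']
    exact Finset.single_le_sum (f := fun j => |a j|) (fun j _ => abs_nonneg _) (Finset.mem_univ j)
  refine Integrable.mono' ((integrable_gaussianBump θ b).abs.const_mul t)
    (((measurable_gaussianBump θ a).mul (measurable_gaussianBump θ b)).div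
      (measurable_finiteMixture θ _)).aestronglyMeasurable (Filter.Eventually.of_forall fun y => ?_)
  have hf := finiteMixture_const_pos θ hw hdw y
  rw [Real.norm_eq_abs, abs_div, abs_mul, abs_of_pos hf, div_le_iff₀ hf]
  have := abs_gaussianBump_le θ hdw ht0 ha y
  nlinarith [abs_nonneg (gaussianBump θ b y)]

theorem bumpInner_comm (w : ℝ) (a b : Fin d → ℝ) : bumpInner θ w a b = bumpInner θ w b a := by
  simp only [bumpInner, mul_comm]

theorem bumpInner_sum_smul {w : ℝ} (hw : 0 < w) (hdw : d * w ≤ 1 / 2) (a b : Fin d → ℝ) :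
    bumpInner θ w a b =
      ∑ i, ∑ j, a i * b j * bumpInner θ w (Pi.single i 1) (Pi.single j 1) := by
  have hs : ∀ i y, gaussianBump θ (Pi.single i 1) y =
      gaussianPDFReal (θ i) 1 y - gaussianPDFReal 0 1 y := by
    intro i y
    simp [gaussianBump, Pi.single_apply]
  have hsum : ∀ (a : Fin d → ℝ) y, gaussianBump θ a y =
      ∑ i, a i * gaussianBump θ (Pi.single i 1) y := by
    intro a y
    simp only [hs]; rfl
  have hpt : ∀ y, gaussianBump θ a y * gaussianBump θ b y / finiteMixture θ (fun _ => w) y =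
      ∑ i, ∑ j, a i * b j * (gaussianBump θ (Pi.single i 1) y * gaussianBump θ (Pi.single j 1) y /
        finiteMixture θ (fun _ => w) y) := by
    intro y
    rw [hsum a, hsum b, Finset.sum_mul_sum, Finset.sum_div]
    refine Finset.sum_congr rfl fun i _ => ?_
    rw [Finset.sum_div]
    refine Finset.sum_congr rfl fun j _ => ?_
    ring
  unfold bumpInner
  simp_rw [hpt]
  have hint := fun i j : Fin d =>
    integrable_bumpInner θ hw hdw (Pi.single i (1 : ℝ)) (Pi.single j (1 : ℝ))
  rw [integral_finsetSum _ fun i _ => integrable_finsetSum _ fun j _ => (hint i j).const_mul _]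
  refine Finset.sum_congr rfl fun i _ => ?_
  rw [integral_finsetSum _ fun j _ => (hint i j).const_mul _]
  refine Finset.sum_congr rfl fun j _ => ?_
  rw [integral_const_mul]

open scoped Matrix MatrixOrder in
/-- A positive definite matrix becomes the identity in suitable coordinates. -/
theorem Matrix.PosDef.exists_mul_mul_eq_one {ι : Type*} [Fintype ι] [DecidableEq ι]
    {M : Matrix ι ι ℝ} (hM : M.PosDef) : ∃ A : Matrix ι ι ℝ, Aᵀ * M * A = 1 := by
  have hM0 : 0 ≤ M := Matrix.nonneg_iff_posSemidef.2 hM.posSemidef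
  set B := CFC.sqrt M with hB
  have hBB : B * B = M := CFC.sqrt_mul_sqrt_self M
  have hBs : Bᵀ = B := by
    have := (CFC.sqrt_nonneg M).isSelfAdjoint.star_eq
    rwa [Matrix.star_eq_conjTranspose, Matrix.conjTranspose_eq_transpose_of_trivial] at this
  have hdet : IsUnit B.det := by
    have h1 : B.det * B.det ≠ 0 := by
      rw [← Matrix.det_mul, hBB]; exact hM.det_pos.ne'
    exact isUnit_iff_ne_zero.2 (left_ne_zero_of_mul h1)
  refine ⟨B⁻¹, ?_⟩
  rw [Matrix.transpose_nonsing_inv, hBs, ← hBB, ← mul_assoc, Matrix.nonsing_inv_mul _ hdet, one_mul,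
    Matrix.mul_nonsing_inv _ hdet]

/-- If the coordinates of `a` are controlled by the norm of its bump, then the bumps have orthonormal
coordinates. -/
theorem exists_bumpInner_orthonormal {w K : ℝ} (hw : 0 < w) (hdw : d * w ≤ 1 / 2)
    (hK : ∀ (a : Fin d → ℝ) j, a j ^ 2 ≤ K * bumpInner θ w a a) :
    ∃ A : (Fin d → ℝ) →ₗ[ℝ] (Fin d → ℝ), ∀ u, bumpInner θ w (A u) (A u) = ∑ j, u j ^ 2 := by
  classical
  set M : Matrix (Fin d) (Fin d) ℝ :=
    Matrix.of fun i j => bumpInner θ w (Pi.single i 1) (Pi.single j 1) with hMdef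
  have hquad : ∀ a : Fin d → ℝ, bumpInner θ w a a = a ⬝ᵥ M.mulVec a := by
    intro a
    rw [bumpInner_sum_smul θ hw hdw]
    simp only [dotProduct, Matrix.mulVec, hMdef, Matrix.of_apply, Finset.mul_sum]
    exact Finset.sum_congr rfl fun i _ => Finset.sum_congr rfl fun j _ => by ring
  have hM : M.PosDef := by
    rw [Matrix.posDef_iff_dotProduct_mulVec]
    refine ⟨?_, fun a ha => ?_⟩
    · ext i j
      simp [hMdef, bumpInner_comm θ w (Pi.single j 1)]
    · rw [star_trivial, ← hquad]
      obtain ⟨j, hj⟩ := Function.ne_iff.1 ha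
      have h1 := hK a j
      have h2 : 0 < a j ^ 2 := by have : a j ≠ 0 := hj; positivity
      have h3 : 0 ≤ bumpInner θ w a a := integral_nonneg fun y =>
        div_nonneg (mul_self_nonneg _) (finiteMixture_const_pos θ hw hdw y).le
      rcases h3.eq_or_lt with h | h
      · rw [← h, mul_zero] at h1; linarith
      · exact h
  obtain ⟨A, hA⟩ := hM.exists_mul_mul_eq_one
  refine ⟨Matrix.mulVecLin A, fun u => ?_⟩
  rw [hquad, Matrix.mulVecLin_apply, Matrix.mulVec_mulVec, Matrix.dotProduct_mulVec,
    ← Matrix.vecMul_transpose, Matrix.vecMul_vecMul, ← mul_assoc, hA, Matrix.vecMul_one]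
  simp [dotProduct, sq]

end

/-! ### Test functions -/

/-- The Cauchy–Schwarz inequality, the two factors being weighted by `1 / f` and `f`. -/
theorem sq_integral_mul_le {α : Type*} [MeasurableSpace α] {μ : Measure α} {F g f : α → ℝ}
    (hf : ∀ x, 0 < f x) (hF : Integrable (fun x => F x * F x / f x) μ)
    (hg : Integrable (fun x => g x ^ 2 * f x) μ) (hFg : Integrable (fun x => F x * g x) μ) :
    (∫ x, F x * g x ∂μ) ^ 2 ≤ (∫ x, g x ^ 2 * f x ∂μ) * ∫ x, F x * F x / f x ∂μ := by
  -- The quadratic polynomial `t ↦ ∫ (F - t g f)² / f` is nonnegative, so its discriminant is not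
  -- positive.
  have h : ∀ t : ℝ, 0 ≤ (∫ x, g x ^ 2 * f x ∂μ) * (t * t) + (-2 * ∫ x, F x * g x ∂μ) * t +
      ∫ x, F x * F x / f x ∂μ := by
    intro t
    have : (∫ x, g x ^ 2 * f x ∂μ) * (t * t) + (-2 * ∫ x, F x * g x ∂μ) * t +
        ∫ x, F x * F x / f x ∂μ = ∫ x, (F x - t * g x * f x) ^ 2 / f x ∂μ := by
      have hpt : ∀ x, (F x - t * g x * f x) ^ 2 / f x =
          (t * t) * (g x ^ 2 * f x) + (-2 * t) * (F x * g x) + F x * F x / f x := by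
        intro x
        have := (hf x).ne'
        field_simp
        ring
      simp_rw [hpt]
      have h1 : Integrable (fun x => t * t * (g x ^ 2 * f x)) μ := hg.const_mul _
      have h2 : Integrable (fun x => -2 * t * (F x * g x)) μ := hFg.const_mul _
      have h3 : Integrable (fun x => t * t * (g x ^ 2 * f x) + -2 * t * (F x * g x)) μ := h1.add h2
      rw [integral_add h3 hF, integral_add h1 h2, integral_const_mul, integral_const_mul]
      ring
    rw [this]
    exact integral_nonneg fun x => div_nonneg (sq_nonneg _) (hf x).le
  have := discrim_le_zero h
  unfold discrim at this
  nlinarith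

theorem gaussianPDFReal_mul_exp (θ t y : ℝ) :
    gaussianPDFReal θ 1 y * Real.exp (t * y - t ^ 2 / 2) =
      Real.exp (t * θ) * gaussianPDFReal (θ + t) 1 y := by
  simp only [gaussianPDFReal, NNReal.coe_one, mul_one]
  rw [mul_assoc, ← Real.exp_add, mul_left_comm, ← Real.exp_add]
  congr 2
  ring

theorem integrable_gaussianPDFReal_mul_exp (θ t : ℝ) :
    Integrable fun y => gaussianPDFReal θ 1 y * Real.exp (t * y - t ^ 2 / 2) := by
  simp_rw [gaussianPDFReal_mul_exp]
  exact (integrable_gaussianPDFReal _ _).const_mul _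

theorem integral_gaussianPDFReal_mul_exp (θ t : ℝ) :
    ∫ y, gaussianPDFReal θ 1 y * Real.exp (t * y - t ^ 2 / 2) = Real.exp (t * θ) := by
  simp_rw [gaussianPDFReal_mul_exp]
  rw [integral_const_mul, integral_gaussianPDFReal_eq_one _ one_ne_zero, mul_one]

theorem gaussianPDFReal_mul_exp_sq (θ t y : ℝ) :
    gaussianPDFReal θ 1 y * Real.exp (t * y - t ^ 2 / 2) ^ 2 =
      Real.exp (t ^ 2) * (gaussianPDFReal θ 1 y * Real.exp ((2 * t) * y - (2 * t) ^ 2 / 2)) := by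
  rw [← Real.exp_nat_mul, mul_left_comm, ← Real.exp_add]
  congr 2
  push_cast; ring

theorem integrable_gaussianPDFReal_mul_exp_sq (θ t : ℝ) :
    Integrable fun y => gaussianPDFReal θ 1 y * Real.exp (t * y - t ^ 2 / 2) ^ 2 := by
  simp_rw [gaussianPDFReal_mul_exp_sq]
  exact (integrable_gaussianPDFReal_mul_exp _ _).const_mul _

theorem integral_gaussianPDFReal_mul_exp_sq (θ t : ℝ) :
    ∫ y, gaussianPDFReal θ 1 y * Real.exp (t * y - t ^ 2 / 2) ^ 2 =
      Real.exp (t ^ 2 + 2 * t * θ) := by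
  simp_rw [gaussianPDFReal_mul_exp_sq]
  rw [integral_const_mul, integral_gaussianPDFReal_mul_exp, ← Real.exp_add]

theorem integrable_gaussianBump_mul {d : ℕ} (θ a : Fin d → ℝ) {g : ℝ → ℝ}
    (hg : ∀ η, Integrable fun y => gaussianPDFReal η 1 y * g y) :
    Integrable fun y => gaussianBump θ a y * g y := by
  simp only [gaussianBump, Finset.sum_mul, mul_assoc, sub_mul]
  exact integrable_finsetSum _ fun j _ => ((hg _).sub (hg _)).const_mul _

theorem integral_gaussianBump_mul {d : ℕ} (θ a : Fin d → ℝ) {g : ℝ → ℝ}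
    (hg : ∀ η, Integrable fun y => gaussianPDFReal η 1 y * g y) :
    ∫ y, gaussianBump θ a y * g y =
      ∑ j, a j * ((∫ y, gaussianPDFReal (θ j) 1 y * g y) - ∫ y, gaussianPDFReal 0 1 y * g y) := by
  simp only [gaussianBump, Finset.sum_mul, mul_assoc, sub_mul]
  rw [integral_finsetSum]
  swap
  · exact fun j _ => ((hg _).sub (hg _)).const_mul _
  refine Finset.sum_congr rfl fun j _ => ?_
  rw [integral_const_mul, integral_sub (hg _) (hg _)]

theorem integral_finiteMixture_mul_le {d : ℕ} (θ : Fin d → ℝ) {w C : ℝ} (hw : 0 < w)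
    (hdw : d * w ≤ 1 / 2) {g : ℝ → ℝ} (hg : ∀ η, Integrable fun y => gaussianPDFReal η 1 y * g y)
    (h0 : ∫ y, gaussianPDFReal 0 1 y * g y ≤ C)
    (hθ : ∀ j, ∫ y, gaussianPDFReal (θ j) 1 y * g y ≤ C) :
    ∫ y, finiteMixture θ (fun _ => w) y * g y ≤ C := by
  simp only [finiteMixture, add_mul]
  rw [integral_add (hg 0) (integrable_gaussianBump_mul θ _ hg), integral_gaussianBump_mul θ _ hg,
    ← Finset.mul_sum, Finset.sum_sub_distrib, Finset.sum_const, Finset.card_univ, Fintype.card_fin,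
    nsmul_eq_mul]
  have : ∑ j, ∫ y, gaussianPDFReal (θ j) 1 y * g y ≤ d * C := by
    refine (Finset.sum_le_sum fun j _ => hθ j).trans (le_of_eq ?_)
    simp
  nlinarith [mul_le_mul_of_nonneg_left this hw.le]

/-- The points `(j + 1) * ρ / √d`, `j < d`. -/
noncomputable def gridPoint (d : ℕ) (ρ : ℝ) (j : Fin d) : ℝ := ((j : ℕ) + 1 : ℕ) * ρ / √d

/-- The function dual to the `m`-th grid point. It is a combination of the exponentials
`exp (t y - t² / 2)` with `t = k / √d`, `0 ≤ k ≤ d`. A Gaussian centred at `i ρ / √d` integrates the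
`k`-th of them to the `k`-th power of `exp (i ρ / d)`, so the coefficients of a Lagrange basis
polynomial produce the biorthogonality. -/
theorem exists_dual_testFunction {d : ℕ} (hd : 0 < d) {ρ : ℝ} (hρ : 0 < ρ) (hρ1 : ρ ≤ 1)
    (m : ℕ) (hm : m ≤ d) :
    ∃ g : ℝ → ℝ, (∀ η, Integrable fun y => gaussianPDFReal η 1 y * g y) ∧
      (∀ η, Integrable fun y => gaussianPDFReal η 1 y * g y ^ 2) ∧
      (∀ i : ℕ, i ≤ d →
        ∫ y, gaussianPDFReal (i * ρ / √d) 1 y * g y = if i = m then 1 else 0) ∧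
      ∀ i : ℕ, i ≤ d →
        ∫ y, gaussianPDFReal (i * ρ / √d) 1 y * g y ^ 2 ≤ ((Real.exp 6 / ρ) ^ d) ^ 2 := by
  obtain ⟨c, hc, hS⟩ := exists_lagrange_coeff hd hρ hρ1 m hm
  have hd' : (0 : ℝ) < d := by exact_mod_cast hd
  have hsd : 0 < √(d : ℝ) := Real.sqrt_pos.2 hd'
  have hss : √(d : ℝ) * √(d : ℝ) = d := Real.mul_self_sqrt hd'.le
  set t : ℕ → ℝ := fun k => k / √d with ht
  set e : ℕ → ℝ → ℝ := fun k y => Real.exp (t k * y - t k ^ 2 / 2) with he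
  set S := ∑ k ∈ Finset.range (d + 1), |c k| with hSdef
  have hS0 : 0 ≤ S := Finset.sum_nonneg fun k _ => abs_nonneg _
  have htθ : ∀ i k : ℕ, t k * (i * ρ / √d) = k * (i * ρ / d) := by
    intro i k
    calc t k * (i * ρ / √d) = k * (i * ρ / (√d * √d)) := by simp only [ht]; field_simp
      _ = _ := by rw [hss]
  set g : ℝ → ℝ := fun y => ∑ k ∈ Finset.range (d + 1), c k * e k y with hg
  have hgm : Measurable g := by
    refine Finset.measurable_sum _ fun k _ => ?_
    simp only [he]
    fun_prop
  have hint1 : ∀ η k, Integrable fun y => c k * (gaussianPDFReal η 1 y * e k y) := fun η k =>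
    (integrable_gaussianPDFReal_mul_exp η (t k)).const_mul _
  have hint2 : ∀ η k, Integrable fun y => |c k| * (gaussianPDFReal η 1 y * e k y ^ 2) :=
    fun η k => (integrable_gaussianPDFReal_mul_exp_sq η (t k)).const_mul _
  have hpt1 : ∀ η y, gaussianPDFReal η 1 y * g y =
      ∑ k ∈ Finset.range (d + 1), c k * (gaussianPDFReal η 1 y * e k y) := by
    intro η y
    simp only [hg, Finset.mul_sum]
    exact Finset.sum_congr rfl fun k _ => by ring
  have hpt2 : ∀ η y, gaussianPDFReal η 1 y * g y ^ 2 ≤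
      S * ∑ k ∈ Finset.range (d + 1), |c k| * (gaussianPDFReal η 1 y * e k y ^ 2) := by
    intro η y
    have h1 : g y ^ 2 ≤ S * ∑ k ∈ Finset.range (d + 1), |c k| * e k y ^ 2 := by
      refine Finset.sum_sq_le_sum_mul_sum_of_sq_le_mul _ (fun k _ => abs_nonneg _)
        (fun k _ => by positivity) fun k _ => ?_
      refine le_of_eq ?_
      rw [← mul_assoc, abs_mul_abs_self]; ring
    calc _ ≤ gaussianPDFReal η 1 y * (S * ∑ k ∈ Finset.range (d + 1), |c k| * e k y ^ 2) :=
          mul_le_mul_of_nonneg_left h1 (gaussianPDFReal_nonneg _ _ _)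
      _ = _ := by
          rw [mul_left_comm, Finset.mul_sum]
          congr 1
          exact Finset.sum_congr rfl fun k _ => by ring
  have hdom : ∀ η, Integrable fun y =>
      S * ∑ k ∈ Finset.range (d + 1), |c k| * (gaussianPDFReal η 1 y * e k y ^ 2) := fun η =>
    (integrable_finsetSum _ fun k _ => hint2 η k).const_mul _
  have hsq : ∀ η, Integrable fun y => gaussianPDFReal η 1 y * g y ^ 2 := by
    intro η
    refine (hdom η).mono' ((measurable_gaussianPDFReal η 1).mul
      (hgm.pow_const 2)).aestronglyMeasurable (Filter.Eventually.of_forall fun y => ?_)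
    rw [Real.norm_eq_abs, abs_of_nonneg (mul_nonneg (gaussianPDFReal_nonneg _ _ _) (sq_nonneg _))]
    exact hpt2 η y
  refine ⟨g, fun η => ?_, hsq, fun i hi => ?_, fun i hi => ?_⟩
  · simp_rw [hpt1]
    exact integrable_finsetSum _ fun k _ => hint1 η k
  · simp_rw [hpt1]
    rw [integral_finsetSum _ fun k _ => hint1 _ k, ← hc i hi]
    refine Finset.sum_congr rfl fun k _ => ?_
    rw [integral_const_mul, integral_gaussianPDFReal_mul_exp, htθ, ← Real.exp_nat_mul]
  · calc _ ≤ ∫ y, S * ∑ k ∈ Finset.range (d + 1),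
            |c k| * (gaussianPDFReal (i * ρ / √d) 1 y * e k y ^ 2) :=
          integral_mono (hsq _) (hdom _) fun y => hpt2 _ y
      _ = S * ∑ k ∈ Finset.range (d + 1), |c k| * Real.exp (t k ^ 2 + 2 * t k * (i * ρ / √d)) := by
          rw [integral_const_mul, integral_finsetSum _ fun k _ => hint2 _ k]
          congr 1
          refine Finset.sum_congr rfl fun k _ => ?_
          rw [integral_const_mul, integral_gaussianPDFReal_mul_exp_sq]
      _ ≤ S * ∑ k ∈ Finset.range (d + 1), |c k| * Real.exp (4 * d) := by
          gcongr with k hk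
          have hk' : (k : ℝ) ≤ d := by
            have := Finset.mem_range.1 hk
            exact_mod_cast (by omega : k ≤ d)
          have hi' : (i : ℝ) ≤ d := by exact_mod_cast hi
          have h1 : t k ^ 2 ≤ d := by
            simp only [ht]
            rw [div_pow, Real.sq_sqrt hd'.le, div_le_iff₀ hd', sq]
            gcongr
          have h2 : t k * (i * ρ / √d) ≤ d := by
            rw [htθ]
            have : (i : ℝ) * ρ / d ≤ 1 := by
              rw [div_le_one hd']; nlinarith
            have h0 : (0 : ℝ) ≤ i * ρ / d := by positivity
            nlinarith
          nlinarith
      _ = S ^ 2 * Real.exp (4 * d) := by rw [← Finset.sum_mul, ← hSdef]; ring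
      _ ≤ ((Real.exp 4 / ρ) ^ d) ^ 2 * Real.exp (4 * d) := by gcongr
      _ = ((Real.exp 6 / ρ) ^ d) ^ 2 := by
          have h6 : Real.exp 6 = Real.exp 4 * Real.exp 2 := by rw [← Real.exp_add]; norm_num
          have h4 : Real.exp (4 * d) = (Real.exp 2 ^ d) ^ 2 := by
            rw [← Real.exp_nat_mul, ← Real.exp_nat_mul]; congr 1; push_cast; ring
          rw [h4, h6, ← mul_pow, ← mul_pow]
          congr 2
          ring

/-- The mass moved to each grid point is controlled by the norm of the bump: the coordinates are
recovered by pairing with the dual test functions. -/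
theorem sq_le_mul_bumpInner {d : ℕ} (hd : 0 < d) {ρ w : ℝ} (hρ : 0 < ρ) (hρ1 : ρ ≤ 1)
    (hw : 0 < w) (hdw : d * w ≤ 1 / 2) (a : Fin d → ℝ) (j : Fin d) :
    a j ^ 2 ≤ ((Real.exp 6 / ρ) ^ d) ^ 2 * bumpInner (gridPoint d ρ) w a a := by
  obtain ⟨g, hg1, hg2, hval, hsq⟩ := exists_dual_testFunction hd hρ hρ1 (j + 1) (by omega)
  have hL : ∫ y, gaussianBump (gridPoint d ρ) a y * g y = a j := by
    rw [integral_gaussianBump_mul _ _ hg1]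
    have h0 : ∫ y, gaussianPDFReal 0 1 y * g y = 0 := by
      have := hval 0 (Nat.zero_le d)
      simpa using this
    rw [Finset.sum_eq_single j]
    · rw [h0, gridPoint, hval _ (by omega), if_pos rfl]; ring
    · intro i _ hij
      rw [h0, gridPoint, hval _ (by omega), if_neg (fun h => hij (Fin.ext (by omega)))]; ring
    · simp
  have hpos := finiteMixture_const_pos (gridPoint d ρ) hw hdw
  have hsqint : Integrable fun y => g y ^ 2 * finiteMixture (gridPoint d ρ) (fun _ => w) y := by
    have := (hg2 0).add (integrable_gaussianBump_mul (gridPoint d ρ) (fun _ => w) hg2)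
    refine this.congr (Filter.Eventually.of_forall fun y => ?_)
    simp only [finiteMixture, Pi.add_apply]
    ring
  have hN : ∫ y, g y ^ 2 * finiteMixture (gridPoint d ρ) (fun _ => w) y ≤
      ((Real.exp 6 / ρ) ^ d) ^ 2 := by
    simp_rw [mul_comm (g _ ^ 2)]
    refine integral_finiteMixture_mul_le _ hw hdw hg2 ?_ fun i => hsq _ (by omega)
    simpa using hsq 0 (Nat.zero_le d)
  calc a j ^ 2 = (∫ y, gaussianBump (gridPoint d ρ) a y * g y) ^ 2 := by rw [hL]
    _ ≤ _ := sq_integral_mul_le hpos (integrable_bumpInner _ hw hdw a a) hsqint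
        (integrable_gaussianBump_mul _ _ hg1)
    _ ≤ _ := by
        refine mul_le_mul_of_nonneg_right hN (integral_nonneg fun y => ?_)
        exact div_nonneg (mul_self_nonneg _) (hpos y).le

/-! ### A cube of mass perturbations -/

/-- The signs `±1` encoding a vertex of the Boolean cube. -/
def cubeSign {d : ℕ} (u : Fin d → Bool) (j : Fin d) : ℝ := if u j then 1 else -1

theorem sum_sq_cubeSign_sub {d : ℕ} (u v : Fin d → Bool) :
    ∑ j, (cubeSign u j - cubeSign v j) ^ 2 = 4 * hammingDist u v := by
  simp only [hammingDist, Finset.card_filter, Nat.cast_sum, Finset.mul_sum]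
  refine Finset.sum_congr rfl fun j _ => ?_
  simp only [cubeSign]
  cases u j <;> cases v j <;> norm_num

theorem hammingDist_flipBit {d : ℕ} (i : Fin d) (u : Fin d → Bool) :
    hammingDist (flipBit i u) u = 1 := by
  rw [hammingDist, Finset.card_eq_one]
  refine ⟨i, ?_⟩
  ext j
  rw [Finset.mem_filter, Finset.mem_singleton]
  by_cases h : j = i
  · subst h; simp [flipBit]
  · simp [flipBit, h]

/-- The images of the vertices `±1` under orthonormal coordinates: the bumps form a Boolean cube of
side `2` in `L²(1 / f)`, and the masses moved are bounded. -/
theorem exists_cube {d : ℕ} (hd : 0 < d) {ρ w : ℝ} (hρ : 0 < ρ) (hρ1 : ρ ≤ 1)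
    (hw : 0 < w) (hdw : d * w ≤ 1 / 2) :
    ∃ a : (Fin d → Bool) → Fin d → ℝ,
      (∀ u j, |a u j| ≤ √d * (Real.exp 6 / ρ) ^ d) ∧
      ∀ u v, bumpInner (gridPoint d ρ) w (a u - a v) (a u - a v) = 4 * hammingDist u v := by
  have hK := sq_le_mul_bumpInner hd hρ hρ1 hw hdw
  obtain ⟨A, hA⟩ := exists_bumpInner_orthonormal _ hw hdw hK
  refine ⟨fun u => A (cubeSign u), fun u j => ?_, fun u v => ?_⟩
  · have h1 := hK (A (cubeSign u)) j
    have h2 : ∑ j, cubeSign u j ^ 2 = d := by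
      have : ∀ j, cubeSign u j ^ 2 = 1 := fun j => by unfold cubeSign; split_ifs <;> norm_num
      simp [this]
    rw [hA, h2] at h1
    refine abs_le_of_sq_le_sq ?_ (by positivity)
    rw [mul_pow, Real.sq_sqrt (by positivity)]
    linarith
  · rw [← map_sub, hA]
    exact sum_sq_cubeSign_sub u v

/-! ### Comparison of perturbed mixtures -/

/-- The distribution with mass `p j` at `θ j` and the remaining mass at `0`. -/
noncomputable def finiteMixing {d : ℕ} (θ p : Fin d → ℝ) : Measure ℝ :=
  ENNReal.ofReal (1 - ∑ j, p j) • Measure.dirac 0 +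
    ∑ j, ENNReal.ofReal (p j) • Measure.dirac (θ j)

theorem isProbabilityMeasure_finiteMixing {d : ℕ} (θ : Fin d → ℝ) {p : Fin d → ℝ}
    (hp : ∀ j, 0 ≤ p j) (hs : ∑ j, p j ≤ 1) : IsProbabilityMeasure (finiteMixing θ p) := by
  constructor
  simp only [finiteMixing, Measure.add_apply, Measure.smul_apply, Measure.finsetSum_apply,
    measure_univ, smul_eq_mul, mul_one]
  rw [← ENNReal.ofReal_sum_of_nonneg fun j _ => hp j,
    ← ENNReal.ofReal_add (sub_nonneg.2 hs) (Finset.sum_nonneg fun j _ => hp j)]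
  simp

theorem integral_finiteMixing {d : ℕ} (θ : Fin d → ℝ) {p : Fin d → ℝ}
    (hp : ∀ j, 0 ≤ p j) (hs : ∑ j, p j ≤ 1) (y : ℝ) :
    ∫ η, gaussianPDFReal η 1 y ∂(finiteMixing θ p) = finiteMixture θ p y := by
  have hint : ∀ (c x : ℝ), Integrable (fun η => gaussianPDFReal η 1 y)
      (ENNReal.ofReal c • Measure.dirac x) := fun c x =>
    (integrable_dirac (by simp)).smul_measure ENNReal.ofReal_ne_top
  rw [finiteMixing, integral_add_measure (hint _ _)
    (integrable_finsetSum_measure.2 fun j _ => hint _ _),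
    integral_finsetSum_measure fun j _ => hint _ _, finiteMixture_eq]
  simp only [integral_smul_measure, integral_dirac, smul_eq_mul]
  rw [ENNReal.toReal_ofReal (sub_nonneg.2 hs)]
  congr 1
  exact Finset.sum_congr rfl fun j _ => by rw [ENNReal.toReal_ofReal (hp j)]

theorem finiteMixing_apply_of_zero_notMem {d : ℕ} (θ p : Fin d → ℝ) {S : Set ℝ}
    (hS : MeasurableSet S) (h0 : (0 : ℝ) ∉ S) :
    finiteMixing θ p S = ∑ j, ENNReal.ofReal (p j) * S.indicator 1 (θ j) := by
  simp [finiteMixing, Measure.dirac_apply' _ hS, h0]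

theorem isProbabilityMeasure_gaussianMixtureLaw {d : ℕ} {θ p : Fin d → ℝ} {G : ProbabilityMeasure ℝ}
    (hG : gaussianMixtureDensity G = finiteMixture θ p) :
    IsProbabilityMeasure (gaussianMixtureLaw G) := by
  constructor
  rw [gaussianMixtureLaw, withDensity_apply _ MeasurableSet.univ, setLIntegral_univ,
    ← ofReal_integral_eq_lintegral_ofReal]
  · rw [hG, integral_finiteMixture, ENNReal.ofReal_one]
  · rw [hG]; exact integrable_finiteMixture θ p
  · exact Filter.Eventually.of_forall fun y =>
      integral_nonneg fun η => gaussianPDFReal_nonneg _ _ _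

theorem finiteMixture_sub {d : ℕ} (θ p q : Fin d → ℝ) (y : ℝ) :
    finiteMixture θ p y - finiteMixture θ q y = gaussianBump θ (p - q) y := by
  simp only [finiteMixture, gaussianBump, Pi.sub_apply, sub_mul, Finset.sum_sub_distrib]
  ring

theorem bumpInner_smul_smul {d : ℕ} (θ : Fin d → ℝ) (w c : ℝ) (a b : Fin d → ℝ) :
    bumpInner θ w (c • a) (c • b) = c ^ 2 * bumpInner θ w a b := by
  simp only [bumpInner, gaussianBump_smul, ← integral_const_mul]
  congr 1; ext y
  ring

theorem abs_finiteMixture_sub_le {d : ℕ} (θ : Fin d → ℝ) {w : ℝ} (hdw : d * w ≤ 1 / 2)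
    {p : Fin d → ℝ} (hp : ∀ j, |p j - w| ≤ w / 2) (y : ℝ) :
    |finiteMixture θ p y - finiteMixture θ (fun _ => w) y| ≤
      1 / 2 * finiteMixture θ (fun _ => w) y := by
  rw [finiteMixture_sub]
  refine abs_gaussianBump_le θ hdw (by norm_num) (fun j => ?_) y
  rw [Pi.sub_apply]
  exact (hp j).trans (by linarith)

/-- Where all densities are comparable to `f`, the squared Hellinger distance dominates the squared
distance in `L²(1 / f)`. -/
theorem bumpInner_le_hellingerSq {d : ℕ} (θ : Fin d → ℝ) {w : ℝ} (hw : 0 < w)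
    (hdw : d * w ≤ 1 / 2) {p q : Fin d → ℝ} (hp : ∀ j, |p j - w| ≤ w / 2)
    (hq : ∀ j, |q j - w| ≤ w / 2) :
    ENNReal.ofReal (bumpInner θ w (p - q) (p - q) / 6) ≤
      hellingerSq (finiteMixture θ p) (finiteMixture θ q) := by
  have hint := integrable_bumpInner θ hw hdw (p - q) (p - q)
  have hpos := finiteMixture_const_pos θ hw hdw
  rw [bumpInner, ← integral_div, ofReal_integral_eq_lintegral_ofReal (hint.div_const 6)
    (Filter.Eventually.of_forall fun y =>
      div_nonneg (div_nonneg (mul_self_nonneg _) (hpos y).le) (by norm_num))]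
  refine lintegral_mono fun y => ENNReal.ofReal_le_ofReal ?_
  have hf := hpos y
  have h1 := abs_le.1 (abs_finiteMixture_sub_le θ hdw hp y)
  have h2 := abs_le.1 (abs_finiteMixture_sub_le θ hdw hq y)
  rw [← finiteMixture_sub]
  set f := finiteMixture θ (fun _ => w) y
  set P := finiteMixture θ p y
  set Q := finiteMixture θ q y
  have hP : √P * √P = P := Real.mul_self_sqrt (by linarith)
  have hQ : √Q * √Q = Q := Real.mul_self_sqrt (by linarith)
  rw [div_div, div_le_iff₀ (by positivity)]
  have h3 : (√P + √Q) ^ 2 ≤ f * 6 := by nlinarith [sq_nonneg (√P - √Q)]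
  calc (P - Q) * (P - Q) = (√P - √Q) ^ 2 * (√P + √Q) ^ 2 := by
        nth_rewrite 1 2 [← hP, ← hQ]; ring
    _ ≤ _ := by gcongr

/-- Where all densities are comparable to `f`, the `χ²` divergence is dominated by the squared
distance in `L²(1 / f)`. -/
theorem exists_likelihoodRatio {d : ℕ} (θ : Fin d → ℝ) {w : ℝ} (hw : 0 < w)
    (hdw : d * w ≤ 1 / 2) {p q : Fin d → ℝ} (hp : ∀ j, |p j - w| ≤ w / 2)
    {G G' : ProbabilityMeasure ℝ} (hG : gaussianMixtureDensity G = finiteMixture θ p)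
    (hG' : gaussianMixtureDensity G' = finiteMixture θ q) :
    ∃ L : ℝ → ℝ≥0∞, Measurable L ∧
      gaussianMixtureLaw G' = (gaussianMixtureLaw G).withDensity L ∧
      ∫⁻ x, L x ^ 2 ∂(gaussianMixtureLaw G) ≤
        ENNReal.ofReal (1 + 2 * bumpInner θ w (q - p) (q - p)) := by
  have hpos := finiteMixture_const_pos θ hw hdw
  have hlow : ∀ y, finiteMixture θ (fun _ => w) y / 2 ≤ finiteMixture θ p y := fun y => by
    have := abs_le.1 (abs_finiteMixture_sub_le θ hdw hp y)
    linarith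
  have hP : ∀ y, 0 < finiteMixture θ p y := fun y => (half_pos (hpos y)).trans_le (hlow y)
  have hmp := measurable_finiteMixture θ p
  have hmq := measurable_finiteMixture θ q
  have hL : Measurable fun y => ENNReal.ofReal (finiteMixture θ q y / finiteMixture θ p y) := by
    fun_prop
  refine ⟨_, hL, ?_, ?_⟩
  · rw [gaussianMixtureLaw, gaussianMixtureLaw, hG, hG',
      ← withDensity_mul _ (by fun_prop) hL]
    congr 1; ext y
    rw [Pi.mul_apply, ← ENNReal.ofReal_mul (hP y).le, mul_div_cancel₀ _ (hP y).ne']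
  · rw [gaussianMixtureLaw, hG,
      lintegral_withDensity_eq_lintegral_mul _ (by fun_prop) (hL.pow_const 2)]
    have hint := integrable_bumpInner θ hw hdw (q - p) (q - p)
    -- `q² / p = p + 2 (q - p) + (q - p)² / p`, where `p ≥ f / 2`.
    set U : ℝ → ℝ := fun y => finiteMixture θ p y + 2 * gaussianBump θ (q - p) y +
      2 * (gaussianBump θ (q - p) y * gaussianBump θ (q - p) y / finiteMixture θ (fun _ => w) y)
      with hU
    have h1 := integrable_finiteMixture θ p
    have h2 : Integrable fun y => 2 * gaussianBump θ (q - p) y :=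
      (integrable_gaussianBump θ (q - p)).const_mul 2
    have h12 : Integrable fun y => finiteMixture θ p y + 2 * gaussianBump θ (q - p) y := h1.add h2
    have hUint : Integrable U := h12.add (hint.const_mul 2)
    have hle : ∀ y, finiteMixture θ p y * (finiteMixture θ q y / finiteMixture θ p y) ^ 2 ≤
        U y := by
      intro y
      have hb := finiteMixture_sub θ q p y
      have h5 : gaussianBump θ (q - p) y * gaussianBump θ (q - p) y / finiteMixture θ p y ≤
          2 * (gaussianBump θ (q - p) y * gaussianBump θ (q - p) y /
            finiteMixture θ (fun _ => w) y) := by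
        calc _ ≤ gaussianBump θ (q - p) y * gaussianBump θ (q - p) y /
              (finiteMixture θ (fun _ => w) y / 2) :=
              div_le_div_of_nonneg_left (mul_self_nonneg _) (half_pos (hpos y)) (hlow y)
          _ = _ := by have := (hpos y).ne'; field_simp
      refine le_trans (le_of_eq ?_) (add_le_add_right h5 _)
      rw [← hb]
      have := (hP y).ne'
      field_simp
      ring
    have hnn : ∀ y, 0 ≤ finiteMixture θ p y * (finiteMixture θ q y / finiteMixture θ p y) ^ 2 :=
      fun y => mul_nonneg (hP y).le (sq_nonneg _)
    have hval : ∫ y, U y = 1 + 2 * bumpInner θ w (q - p) (q - p) := by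
      have h0 : ∫ y, gaussianBump θ (q - p) y = 0 := by
        simp_rw [← finiteMixture_sub]
        rw [integral_sub (integrable_finiteMixture _ _) (integrable_finiteMixture _ _),
          integral_finiteMixture, integral_finiteMixture, sub_self]
      rw [hU, integral_add h12 (hint.const_mul 2), integral_add h1 h2, integral_const_mul, h0,
        integral_finiteMixture, integral_const_mul]
      simp [bumpInner]
    rw [← hval, ofReal_integral_eq_lintegral_ofReal hUint
      (Filter.Eventually.of_forall fun y => (hnn y).trans (hle y))]
    refine lintegral_mono_ae (Filter.Eventually.of_forall fun y => ?_)
    have hoq : ENNReal.ofReal (finiteMixture θ q y / finiteMixture θ p y) ^ 2 ≤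
        ENNReal.ofReal ((finiteMixture θ q y / finiteMixture θ p y) ^ 2) := by
      rcases le_total 0 (finiteMixture θ q y / finiteMixture θ p y) with h | h
      · rw [ENNReal.ofReal_pow h]
      · simp [ENNReal.ofReal_of_nonpos h]
    calc _ ≤ ENNReal.ofReal (finiteMixture θ p y) *
          ENNReal.ofReal ((finiteMixture θ q y / finiteMixture θ p y) ^ 2) := by
          rw [Pi.mul_apply]; gcongr
      _ = ENNReal.ofReal
          (finiteMixture θ p y * (finiteMixture θ q y / finiteMixture θ p y) ^ 2) :=
          (ENNReal.ofReal_mul (hP y).le).symm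
      _ ≤ _ := ENNReal.ofReal_le_ofReal (hle y)

/-! ### The lower bound in terms of the dimension of the cube -/

theorem exp_neg_natCast_le_half {d : ℕ} (hd : 0 < d) : Real.exp (-(d : ℝ)) ≤ 1 / 2 := by
  rw [Real.exp_neg, one_div]
  refine inv_anti₀ (by norm_num) ?_
  have h1 : (1 : ℝ) ≤ d := by exact_mod_cast hd
  linarith [Real.add_one_le_exp (d : ℝ)]

theorem natCast_mul_sqrt_le_exp (d : ℕ) : (d : ℝ) * √d ≤ Real.exp 2 ^ d := by
  have h1 : (d : ℝ) ≤ Real.exp d := by linarith [Real.add_one_le_exp (d : ℝ)]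
  have h2 : √(d : ℝ) ≤ Real.exp d := by
    rcases Nat.eq_zero_or_pos d with rfl | hd
    · simp
    · have : (1 : ℝ) ≤ d := by exact_mod_cast hd
      exact (Real.sqrt_le_iff.2 ⟨by linarith, by nlinarith⟩).trans h1
  calc (d : ℝ) * √d ≤ Real.exp d * Real.exp d := by gcongr
    _ = Real.exp 2 ^ d := by
      rw [← Real.exp_add, ← Real.exp_nat_mul]; congr 1; ring

/-- A class of priors containing all mixing distributions that put at most `3/2 * exp (-d) / d` on
each point of the grid and the rest at `0` has minimax risk of order at least `d / n`, as soon as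
`n` is so large that perturbations of size `1 / √n` keep the masses comparable. -/
theorem le_minimaxHellingerRisk_of_grid {d n : ℕ} (hd : 0 < d) (hn : 0 < n) {ρ : ℝ} (hρ : 0 < ρ)
    (hρ1 : ρ ≤ 1) (hdn : (Real.exp 9 / ρ) ^ d ≤ √n) {𝒢 : Set (ProbabilityMeasure ℝ)}
    (h𝒢 : ∀ p : Fin d → ℝ, (∀ j, 0 ≤ p j) → (∀ j, p j ≤ 3 / 2 * (Real.exp (-d) / d)) →
      ∀ G : ProbabilityMeasure ℝ, (G : Measure ℝ) = finiteMixing (gridPoint d ρ) p → G ∈ 𝒢) :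
    ENNReal.ofReal (d / (384 * n)) ≤ minimaxHellingerRisk n 𝒢 := by
  have hd' : (0 : ℝ) < d := by exact_mod_cast hd
  have hn' : (0 : ℝ) < n := by exact_mod_cast hn
  have hsn : 0 < √(n : ℝ) := Real.sqrt_pos.2 hn'
  set w : ℝ := Real.exp (-d) / d with hwdef
  have hw : 0 < w := by positivity
  have hdw' : d * w = Real.exp (-d) := by rw [hwdef]; field_simp
  have hdw : d * w ≤ 1 / 2 := hdw' ▸ exp_neg_natCast_le_half hd
  obtain ⟨a, ha, hinner⟩ := exists_cube hd hρ hρ1 hw hdw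
  -- At this scale the `χ²` divergence of neighbouring vertices is at most `1 / n`.
  set δ : ℝ := √(1 / (8 * n)) with hδ
  have hδ0 : 0 ≤ δ := Real.sqrt_nonneg _
  have hδ2 : δ ^ 2 = 1 / (8 * n) := Real.sq_sqrt (by positivity)
  have hδn : δ * √n ≤ 1 / 2 := by
    refine abs_le_of_sq_le_sq (b := 1 / 2) ?_ (by norm_num) |> fun h => (le_abs_self _).trans h
    rw [mul_pow, hδ2, Real.sq_sqrt hn'.le]
    field_simp
    norm_num
  set p : (Fin d → Bool) → Fin d → ℝ := fun u => (fun _ => w) + δ • a u with hpdef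
  have hpw : ∀ u j, |p u j - w| ≤ w / 2 := by
    intro u j
    have h1 : p u j - w = δ * a u j := by simp [hpdef]
    rw [h1, abs_mul, abs_of_nonneg hδ0]
    have h9 : Real.exp 9 = Real.exp 2 * Real.exp 1 * Real.exp 6 := by
      rw [← Real.exp_add, ← Real.exp_add]; norm_num
    have h2 : d * √d * Real.exp d * (Real.exp 6 / ρ) ^ d ≤ √n := by
      refine le_trans ?_ hdn
      rw [h9, mul_div_assoc, mul_pow, mul_pow]
      have : Real.exp 1 ^ d = Real.exp d := by rw [← Real.exp_nat_mul]; simp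
      rw [this]
      gcongr
      exact natCast_mul_sqrt_le_exp d
    have h3 : √d * (Real.exp 6 / ρ) ^ d ≤ √n * w := by
      have h4 : √n * w = √n / (d * Real.exp d) := by
        rw [hwdef, Real.exp_neg]; field_simp
      rw [h4, le_div_iff₀ (by positivity)]
      linarith
    calc δ * |a u j| ≤ δ * (√n * w) := by gcongr; exact (ha u j).trans h3
      _ = δ * √n * w := by ring
      _ ≤ 1 / 2 * w := by gcongr
      _ = w / 2 := by ring
  have hp0 : ∀ u j, 0 ≤ p u j := fun u j => by
    have := abs_le.1 (hpw u j); linarith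
  have hp1 : ∀ u j, p u j ≤ 3 / 2 * w := fun u j => by
    have := abs_le.1 (hpw u j); linarith
  have hps : ∀ u, ∑ j, p u j ≤ 1 := by
    intro u
    refine (Finset.sum_le_sum fun j _ => hp1 u j).trans ?_
    rw [Finset.sum_const, Finset.card_univ, Fintype.card_fin, nsmul_eq_mul]
    linarith
  set G : (Fin d → Bool) → ProbabilityMeasure ℝ := fun u =>
    ⟨finiteMixing (gridPoint d ρ) (p u), isProbabilityMeasure_finiteMixing _ (hp0 u) (hps u)⟩
  have hGd : ∀ u, gaussianMixtureDensity (G u) = finiteMixture (gridPoint d ρ) (p u) := fun u =>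
    funext fun y => integral_finiteMixing _ (hp0 u) (hps u) y
  have hdiff : ∀ u v, bumpInner (gridPoint d ρ) w (p u - p v) (p u - p v) =
      hammingDist u v / (2 * n) := by
    intro u v
    have : p u - p v = δ • (a u - a v) := by
      ext j; simp [hpdef]; ring
    rw [this, bumpInner_smul_smul, hinner, hδ2]
    field_simp
    ring
  have hκ : ∀ u v, ENNReal.ofReal (1 / (12 * n)) * hammingDist u v ≤
      hellingerSq (gaussianMixtureDensity (G u)) (gaussianMixtureDensity (G v)) := by
    intro u v
    rw [hGd, hGd]
    refine le_trans (le_of_eq ?_) (bumpInner_le_hellingerSq _ hw hdw (hpw u) (hpw v))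
    rw [hdiff, ← ENNReal.ofReal_natCast, ← ENNReal.ofReal_mul (by positivity)]
    congr 1
    field_simp
    ring
  have hfin := le_minimaxHellingerRisk_of_cube (n := n) (𝒢 := 𝒢) G
    (fun u => h𝒢 (p u) (hp0 u) (hp1 u) _ rfl)
    (fun u => by rw [hGd]; exact measurable_finiteMixture _ _)
    (fun u => isProbabilityMeasure_gaussianMixtureLaw (hGd u)) (by positivity) hκ (fun u i => by
      obtain ⟨L, hL, h1, h2⟩ := exists_likelihoodRatio _ hw hdw (hpw u) (hGd u)
        (hGd (flipBit i u))
      refine ⟨L, hL, h1, h2.trans (le_of_eq ?_)⟩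
      rw [hdiff, hammingDist_flipBit]
      congr 1
      field_simp
      norm_num)
  refine le_trans (le_of_eq ?_) hfin
  congr 1
  field_simp
  norm_num

/-! ### The choice of dimension and spacing -/

theorem gridPoint_nonneg {d : ℕ} {ρ : ℝ} (hρ : 0 ≤ ρ) (j : Fin d) : 0 ≤ gridPoint d ρ j := by
  unfold gridPoint; positivity

theorem gridPoint_le {d : ℕ} {ρ : ℝ} (hρ : 0 ≤ ρ) (j : Fin d) : gridPoint d ρ j ≤ ρ * √d := by
  have hd : (0 : ℝ) < d := by exact_mod_cast (Fin.pos j)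
  have hj : (((j : ℕ) + 1 : ℕ) : ℝ) ≤ d := by exact_mod_cast j.2
  unfold gridPoint
  rw [div_le_iff₀ (Real.sqrt_pos.2 hd), mul_assoc, Real.mul_self_sqrt hd.le, mul_comm]
  gcongr

theorem finiteMixing_gridPoint_compl_Icc_eq_zero {d : ℕ} {ρ h : ℝ} (hρ : 0 ≤ ρ) (hh : 0 ≤ h)
    (hle : ρ * √d ≤ h) (p : Fin d → ℝ) :
    finiteMixing (gridPoint d ρ) p (Set.Icc (-h) h)ᶜ = 0 := by
  rw [finiteMixing_apply_of_zero_notMem _ _ measurableSet_Icc.compl (by simp [hh])]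
  refine Finset.sum_eq_zero fun j _ => ?_
  rw [Set.indicator_of_notMem, mul_zero]
  have h1 := gridPoint_nonneg hρ j
  have h2 := gridPoint_le hρ j
  simp only [Set.mem_compl_iff, Set.mem_Icc, not_not]
  constructor <;> linarith

theorem finiteMixing_mem_subgaussianPriors {d : ℕ} {ρ s : ℝ} (hd : 0 < d) (hρ : 0 ≤ ρ) (hs : 0 < s)
    (hρs : ρ ^ 2 ≤ 2 * s) {p : Fin d → ℝ} (hp0 : ∀ j, 0 ≤ p j)
    (hp1 : ∀ j, p j ≤ 3 / 2 * (Real.exp (-d) / d)) {G : ProbabilityMeasure ℝ}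
    (hG : (G : Measure ℝ) = finiteMixing (gridPoint d ρ) p) : G ∈ subgaussianPriors s := by
  intro t ht
  have hd' : (0 : ℝ) < d := by exact_mod_cast hd
  rw [hG]
  rcases le_or_gt (ρ * √d) t with h | h
  · rw [finiteMixing_gridPoint_compl_Icc_eq_zero hρ ht.le h]
    exact zero_le
  · rw [finiteMixing_apply_of_zero_notMem _ _ measurableSet_Icc.compl (by simp [ht.le])]
    calc _ ≤ ∑ j, ENNReal.ofReal (p j) := by
          refine Finset.sum_le_sum fun j _ => mul_le_of_le_one_right' ?_
          exact Set.indicator_le_self' (fun _ _ => zero_le) _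
      _ = ENNReal.ofReal (∑ j, p j) := (ENNReal.ofReal_sum_of_nonneg fun j _ => hp0 j).symm
      _ ≤ _ := by
          refine ENNReal.ofReal_le_ofReal ?_
          have h1 : ∑ j, p j ≤ 3 / 2 * Real.exp (-d) := by
            refine (Finset.sum_le_sum fun j _ => hp1 j).trans (le_of_eq ?_)
            rw [Finset.sum_const, Finset.card_univ, Fintype.card_fin, nsmul_eq_mul]
            field_simp
          have h2 : Real.exp (-d) ≤ Real.exp (-t ^ 2 / (2 * s)) := by
            refine Real.exp_le_exp.2 ?_
            have h3 : t ^ 2 ≤ 2 * s * d := by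
              calc t ^ 2 ≤ (ρ * √d) ^ 2 := by gcongr
                _ = ρ ^ 2 * d := by rw [mul_pow, Real.sq_sqrt hd'.le]
                _ ≤ _ := by gcongr
            rw [le_div_iff₀ (by positivity)]
            linarith
          linarith [Real.exp_pos (-(d : ℝ))]

theorem tendsto_log_natCast_atTop :
    Filter.Tendsto (fun n : ℕ => Real.log n) Filter.atTop Filter.atTop :=
  Real.tendsto_log_atTop.comp tendsto_natCast_atTop_atTop

theorem half_le_natFloor {x : ℝ} (hx : 1 ≤ x) : x / 2 ≤ ⌊x⌋₊ := by
  have h1 := Nat.lt_floor_add_one x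
  have h2 : (1 : ℝ) ≤ ⌊x⌋₊ := by exact_mod_cast (Nat.one_le_floor_iff x).2 hx
  linarith

theorem pow_le_sqrt_of_mul_log_le {K : ℝ} (hK : 0 < K) {d n : ℕ} (hn : 0 < n)
    (h : d * Real.log K ≤ Real.log n / 2) : K ^ d ≤ √n := by
  have hn' : (0 : ℝ) < n := by exact_mod_cast hn
  rw [← Real.log_le_log_iff (by positivity) (Real.sqrt_pos.2 hn'), Real.log_pow,
    Real.log_sqrt hn'.le]
  exact h

/-- The subgaussian case: a grid of fixed `ρ` is spread over an interval of length `ρ √d`, which the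
tail condition allows because the masses are exponentially small in `d`. -/
theorem exists_le_minimaxHellingerRisk_subgaussianPriors {s : ℝ} (hs : 0 < s) :
    ∃ c₁ : ℝ, 0 < c₁ ∧ ∃ n₀ : ℕ, ∀ n : ℕ, n₀ ≤ n →
      ENNReal.ofReal (c₁ / n * Real.log n) ≤ minimaxHellingerRisk n (subgaussianPriors s) := by
  set ρ : ℝ := min 1 √(2 * s) with hρdef
  have hρ : 0 < ρ := lt_min one_pos (Real.sqrt_pos.2 (by positivity))
  have hρ1 : ρ ≤ 1 := min_le_left _ _
  have hρs : ρ ^ 2 ≤ 2 * s := by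
    calc ρ ^ 2 ≤ √(2 * s) ^ 2 := by gcongr; exact min_le_right _ _
      _ = 2 * s := Real.sq_sqrt (by positivity)
  set ℓ := Real.log (Real.exp 9 / ρ) with hℓ
  have hℓ0 : 0 < ℓ := by
    refine Real.log_pos ?_
    rw [lt_div_iff₀ hρ]
    have : (1 : ℝ) < Real.exp 9 := Real.one_lt_exp_iff.2 (by norm_num)
    linarith
  have hev : ∀ᶠ n : ℕ in Filter.atTop, 0 < n ∧ 2 * ℓ ≤ Real.log n :=
    (Filter.eventually_gt_atTop 0).and (tendsto_log_natCast_atTop.eventually_ge_atTop _)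
  obtain ⟨n₀, hn₀⟩ := Filter.eventually_atTop.1 hev
  refine ⟨1 / (1536 * ℓ), by positivity, n₀, fun n hn => ?_⟩
  obtain ⟨hnpos, hlog⟩ := hn₀ n hn
  have hn' : (0 : ℝ) < n := by exact_mod_cast hnpos
  set x := Real.log n / (2 * ℓ) with hx
  have hx1 : 1 ≤ x := by rw [hx, le_div_iff₀ (by positivity)]; linarith
  have hd : 0 < ⌊x⌋₊ := Nat.floor_pos.2 hx1
  have hfloor : (⌊x⌋₊ : ℝ) ≤ x := Nat.floor_le (by linarith)
  have hdn : (Real.exp 9 / ρ) ^ ⌊x⌋₊ ≤ √n := by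
    refine pow_le_sqrt_of_mul_log_le (by positivity) hnpos ?_
    calc (⌊x⌋₊ : ℝ) * ℓ ≤ x * ℓ := by gcongr
      _ = Real.log n / 2 := by rw [hx]; field_simp
  refine le_trans (ENNReal.ofReal_le_ofReal ?_) (le_minimaxHellingerRisk_of_grid hd hnpos hρ hρ1 hdn
    fun p hp0 hp1 G hG => finiteMixing_mem_subgaussianPriors hd hρ.le hs hρs hp0 hp1 hG)
  have := half_le_natFloor hx1
  calc 1 / (1536 * ℓ) / n * Real.log n = x / 2 / (384 * n) := by rw [hx]; field_simp; ring
    _ ≤ _ := by gcongr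

/-- The compactly supported case: with `ρ = h / √d` the grid stays in `[0, h]`, and the condition on
`n` becomes `d ^ d ≲ n`. -/
theorem exists_le_minimaxHellingerRisk_supportedPriors {h : ℝ} (hh : 0 < h) :
    ∃ c₀ : ℝ, 0 < c₀ ∧ ∃ n₀ : ℕ, ∀ n : ℕ, n₀ ≤ n →
      ENNReal.ofReal (c₀ / n * (Real.log n / Real.log (Real.log n))) ≤
        minimaxHellingerRisk n (supportedPriors h) := by
  -- `log x` is small enough for `d = ⌊x / (4 log x)⌋` to exceed `h²`, so that `h / √d ≤ 1`.
  have hev1 : ∀ᶠ x : ℝ in Filter.atTop, ‖Real.log x‖ ≤ 1 / (4 * (h ^ 2 + 1)) * ‖x‖ :=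
    Real.isLittleO_log_id_atTop.def (by positivity)
  have hev2 : ∀ᶠ x : ℝ in Filter.atTop, 1 ≤ Real.log x :=
    Real.tendsto_log_atTop.eventually_ge_atTop _
  have hev3 : ∀ᶠ x : ℝ in Filter.atTop, 9 - Real.log h ≤ Real.log x :=
    Real.tendsto_log_atTop.eventually_ge_atTop _
  have hev : ∀ᶠ n : ℕ in Filter.atTop, 0 < n ∧ 0 < Real.log n ∧
      ‖Real.log (Real.log n)‖ ≤ 1 / (4 * (h ^ 2 + 1)) * ‖Real.log n‖ ∧
      1 ≤ Real.log (Real.log n) ∧ 9 - Real.log h ≤ Real.log (Real.log n) :=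
    (Filter.eventually_gt_atTop 0).and ((tendsto_log_natCast_atTop.eventually_gt_atTop _).and
      ((tendsto_log_natCast_atTop.eventually hev1).and
        ((tendsto_log_natCast_atTop.eventually hev2).and
          (tendsto_log_natCast_atTop.eventually hev3))))
  obtain ⟨n₀, hn₀⟩ := Filter.eventually_atTop.1 hev
  refine ⟨1 / 3072, by norm_num, n₀, fun n hn => ?_⟩
  obtain ⟨hnpos, hL, hsmall, hℓ1, hℓh⟩ := hn₀ n hn
  have hn' : (0 : ℝ) < n := by exact_mod_cast hnpos
  set L := Real.log n with hLdef
  set ℓ := Real.log L with hℓ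
  have hℓ0 : 0 < ℓ := by linarith
  rw [Real.norm_of_nonneg hℓ0.le, Real.norm_of_nonneg hL.le, one_div, inv_mul_eq_div,
    le_div_iff₀ (by positivity)] at hsmall
  set x := L / (4 * ℓ) with hx
  have hxh : h ^ 2 + 1 ≤ x := by
    rw [hx, le_div_iff₀ (by positivity)]
    linarith
  have hx1 : 1 ≤ x := by nlinarith
  set d := ⌊x⌋₊ with hddef
  have hd : 0 < d := Nat.floor_pos.2 hx1
  have hd' : (0 : ℝ) < d := by exact_mod_cast hd
  have hfloor : (d : ℝ) ≤ x := Nat.floor_le (by linarith)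
  have hsd : 0 < √(d : ℝ) := Real.sqrt_pos.2 hd'
  have hdh : h ≤ √d := by
    refine Real.le_sqrt_of_sq_le ?_
    have := Nat.lt_floor_add_one x
    linarith
  have hρ : 0 < h / √d := by positivity
  have hρ1 : h / √d ≤ 1 := (div_le_one hsd).2 hdh
  have hρd : h / √d * √d = h := div_mul_cancel₀ _ hsd.ne'
  have hdn : (Real.exp 9 / (h / √d)) ^ d ≤ √n := by
    refine pow_le_sqrt_of_mul_log_le (by positivity) hnpos ?_
    rw [Real.log_div (by positivity) hρ.ne', Real.log_div hh.ne' hsd.ne', Real.log_exp,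
      Real.log_sqrt hd'.le]
    have hlogd : Real.log d ≤ ℓ := by
      refine Real.log_le_log hd' (hfloor.trans ?_)
      rw [hx]
      exact div_le_self hL.le (by linarith)
    calc (d : ℝ) * (9 - (Real.log h - Real.log d / 2)) ≤ d * (2 * ℓ) := by
          gcongr; linarith
      _ ≤ x * (2 * ℓ) := by gcongr
      _ = L / 2 := by rw [hx]; field_simp; norm_num
  refine le_trans (ENNReal.ofReal_le_ofReal ?_) (le_minimaxHellingerRisk_of_grid hd hnpos hρ hρ1 hdn
    fun p _ _ G hG => ?_)
  · have := half_le_natFloor hx1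
    calc 1 / 3072 / (n : ℝ) * (L / ℓ) = x / 2 / (384 * n) := by rw [hx]; field_simp; norm_num
      _ ≤ _ := by gcongr
  · show (G : Measure ℝ) (Set.Icc (-h) h)ᶜ = 0
    rw [hG]
    exact finiteMixing_gridPoint_compl_Icc_eq_zero hρ.le hh.le hρd.le p

theorem mainTheorem6 :
    (∀ h : ℝ, 0 < h → ∃ c₀ : ℝ, 0 < c₀ ∧ ∃ n₀ : ℕ, ∀ n : ℕ, n₀ ≤ n →
      ENNReal.ofReal (c₀ / n * (Real.log n / Real.log (Real.log n))) ≤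
        minimaxHellingerRisk n (supportedPriors h)) ∧
    (∀ s : ℝ, 0 < s → ∃ c₁ : ℝ, 0 < c₁ ∧ ∃ n₀ : ℕ, ∀ n : ℕ, n₀ ≤ n →
      ENNReal.ofReal (c₁ / n * Real.log n) ≤
        minimaxHellingerRisk n (subgaussianPriors s)) :=
  ⟨fun _ hh => exists_le_minimaxHellingerRisk_supportedPriors hh,
    fun _ hs => exists_le_minimaxHellingerRisk_subgaussianPriors hs⟩
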